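/- Let $\mathfrak S_n$ be the symmetric group on $\{1,\dots,n\}$, and for $\sigma\in\mathfrak S_n$ let $\#\sigma$ be its total number of cycles (fixed points included). Put \[ D(\sigma)=\mathrm{card}\{1\le i\le n-1:\sigma(i+1)<\sigma(i)\},\quad A(\sigma)=\mathrm{card}\{1\le i\le n-1:\sigma(i+1)>\sigma(i)\},\quad \mathrm{Exc}(\sigma)=\mathrm{card}\{1\le i\le n:\sigma(i)>i\} \] (the numbers of descents, ascents and exceedances). Let $(\sigma_n)_{n\ge1}$ be a sequence of random permutations, $\sigma_n$ with values in $\mathfrak S_n$, which satisfies $\mathcal{CI}_{1,1}$, that is: - each $\sigma_n$ is conjugacy invariant: $\rho\sigma_n\rho^{-1}$ has the same distribution as $\sigma_n$ for every $\rho\in\mathfrak S_n$; - for every $\varepsilon>0$, $\displaystyle\lim_{n\to\infty}\frac1n\ln\mathbb P\Big(\frac{\#\sigma_n}{n}>\varepsilon\Big)=-\infty$ (with $\ln 0=-\infty$). Then for every $f\in\{D,A,\mathrm{Exc}\}$ and every real $x$ with $\frac12<x<1$, \[ \lim_{n\to\infty}\frac1n\ln\mathbb P\big(f(\sigma_n)\ge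 xn\big)=-I_D(x), \qquad I_D(x)=\sup_{t\in\mathbb R}\Big\{xt-\ln\Big(\frac{e^t-1}{t}\Big)\Big\}, \] where $\frac{e^t-1}{t}$ is understood as its limit $1$ at $t=0$. -/

import Mathlib

open MeasureTheory ProbabilityTheory Filter Topology

/-- The discrete σ-algebra on the (finite) symmetric group. -/
instance permMeasurableSpace (n : ℕ) : MeasurableSpace (Equiv.Perm (Fin n)) := ⊤

/-- The total number of cycles of `σ`, fixed points included
(`cycleType` only lists the cycles of length at least two). -/
def cycleCount {n : ℕ} (σ : Equiv.Perm (Fin n)) : ℕ :=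
  σ.cycleType.card + (Finset.univ.filter fun i : Fin n => σ i = i).card

/-- `D(σ)`, the number of `i` with `i + 1` still in range and `σ (i + 1) < σ i`. -/
def descents (n : ℕ) (σ : Equiv.Perm (Fin n)) : ℕ :=
  (Finset.univ.filter fun i : Fin n => ∃ h : (i : ℕ) + 1 < n, σ ⟨i + 1, h⟩ < σ i).card

/-- `A(σ)`, the number of `i` with `i + 1` still in range and `σ i < σ (i + 1)`. -/
def ascents (n : ℕ) (σ : Equiv.Perm (Fin n)) : ℕ :=
  (Finset.univ.filter fun i : Fin n => ∃ h : (i : ℕ) + 1 < n, σ i < σ ⟨i + 1, h⟩).card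

/-- `Exc(σ)`, the number of `i` with `i < σ i`. -/
def exceedances (n : ℕ) (σ : Equiv.Perm (Fin n)) : ℕ :=
  (Finset.univ.filter fun i : Fin n => i < σ i).card

/-- The random permutation `σ` is conjugacy invariant: `ρ σ ρ⁻¹` has the law of `σ` for
every fixed permutation `ρ`. -/
def ConjInvariant {Ω : Type*} [MeasurableSpace Ω] (P : Measure Ω) {n : ℕ}
    (σ : Ω → Equiv.Perm (Fin n)) : Prop :=
  ∀ ρ : Equiv.Perm (Fin n), IdentDistrib (fun ω => ρ * σ ω * ρ⁻¹) σ P P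

/-- The class `CI_{α,β}`: every `σ n` is conjugacy invariant and, for every `ε > 0`,
`ln P(#σ_n / n^α > ε) / n^β → -∞`. Logarithms take values in `EReal`, with `ln 0 = -∞`. The
`σ n` may live on different probability spaces. -/
def SatisfiesCI (α β : ℝ) {Ω : ℕ → Type*} [∀ n, MeasurableSpace (Ω n)]
    (P : ∀ n, Measure (Ω n)) (σ : ∀ n, Ω n → Equiv.Perm (Fin n)) : Prop :=
  (∀ n, ConjInvariant (P n) (σ n)) ∧
  ∀ ε : ℝ, 0 < ε →
    Tendsto (fun n : ℕ =>
      ENNReal.log (P n {ω | (cycleCount (σ n ω) : ℝ) / (n : ℝ) ^ α > ε})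
        / (((n : ℝ) ^ β : ℝ) : EReal)) atTop (𝓝 ⊥)

/-- The rate function `I_D(x) = sup_t {x t - ln ((e^t - 1) / t)}`, as an extended real. At
`t = 0` Lean's conventions give `ln ((e^t - 1) / t) = ln 0 = 0`, which is also the limit of that
expression as `t → 0`. -/
noncomputable def rateD (x : ℝ) : EReal :=
  ⨆ t : ℝ, ((x * t - Real.log ((Real.exp t - 1) / t) : ℝ) : EReal)

/-!
The proof compares every law in the class with one model, the uniform law on long cycles (cycles
of full length), and computes the large deviations there through the descents of a uniform
permutation.

*Comparison.* A conjugacy invariant `σ` has the law of `ρ σ ρ⁻¹` with `ρ` uniform and independent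
of `σ`. If `σ` has `k` cycles, then listing the elements of its cycles one after the other shows
that some conjugate of `σ` differs from the rotation `c = finRotate n` in at most `k` places
(`exists_conj_hammingDist_finRotate_le_card_orbits`). Conjugating both by the same `ρ` keeps the
number of places where they differ, and each of the three statistics changes by at most two per
such place. Hence the tails of `f (ρ σ ρ⁻¹)` and `f (ρ c ρ⁻¹)` agree up to a shift by `2 k`
(`conjTail_le_conjTail_finRotate`), and the event of more than `ε n` cycles is superexponentially
small by hypothesis. The uniform law belongs to the class as well: Burnside's lemma for colorings
of `Fin n` with `K` colors bounds the mean of `K ^ #σ` by a polynomial in `n`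
(`sum_pow_cycleCount_le`). So for descents and ascents the long cycle can be replaced by a uniform
permutation. For exceedances no such step is needed: the exceedances of `ρ c ρ⁻¹` are the cyclic
ascents of `ρ` (`ascents_le_exceedances_conj_finRotate`).

*Descents of a uniform permutation.* A word over `Fin M` of length `n + 1` with letters `w i` has
`∑ (w (i + 1) - w i mod M) / M` strict descents, up to an error of at most one, and the cyclic
increments of a uniform word are independent and uniform. Letting `M → ∞`, so that repeated letters
become negligible, the moment generating function at `t > 0` of the descents of a uniform
permutation of `n + 1` letters is `((exp t - 1) / t) ^ n` up to a factor between `exp (-t)` and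
`exp t` (`descentMGF_succ_bounds`). The upper bound is then Markov's inequality, and the lower bound is
obtained by an exponential tilt (`eventually_le_uniformTail_descents`): as
`uniformCGF t = log ((exp t - 1) / t)` is differentiable, with slopes that run through `(1/2, 1)`,
the tilted law concentrates at any prescribed such slope.
-/

/-! ### Stability of the statistics, and comparison with the long cycle -/

open Finset in
theorem card_filter_le_of_imp_or_mem {α : Type*} [Fintype α] [DecidableEq α] {p q : α → Prop}
    [DecidablePred p] [DecidablePred q] (B : Finset α) (h : ∀ i, p i → q i ∨ i ∈ B) :
    (univ.filter p).card ≤ (univ.filter q).card + B.card := by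
  refine (card_le_card (t := univ.filter q ∪ B) ?_).trans (card_union_le _ _)
  intro i hi
  simpa using h i (by simpa using hi)

theorem card_exists_succ_ne_le_hammingDist {n : ℕ} (σ τ : Equiv.Perm (Fin n)) :
    (Finset.univ.filter fun i : Fin n =>
      ∃ h : (i : ℕ) + 1 < n, σ ⟨i + 1, h⟩ ≠ τ ⟨i + 1, h⟩).card ≤ hammingDist σ τ := by
  unfold hammingDist
  refine Finset.card_le_card_of_injOn
    (fun i => if h : (i : ℕ) + 1 < n then ⟨i + 1, h⟩ else i) ?_ ?_
  · intro i hi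
    obtain ⟨h, hne⟩ := (Finset.mem_filter.1 hi).2
    simpa [h] using hne
  · intro i hi j hj hij
    obtain ⟨h, -⟩ := (Finset.mem_filter.1 hi).2
    obtain ⟨h', -⟩ := (Finset.mem_filter.1 hj).2
    simp only [h, h', dif_pos, Fin.mk.injEq] at hij
    exact Fin.ext (by omega)

/-- Counting the indices `i` at which a relation holds between `σ i` and `σ (i + 1)`: each place
where `τ` differs from `σ` affects at most two indices. -/
theorem card_filter_succ_le_add_hammingDist {n : ℕ} (r : Fin n → Fin n → Prop) [DecidableRel r]
    (σ τ : Equiv.Perm (Fin n)) :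
    (Finset.univ.filter fun i : Fin n =>
        ∃ h : (i : ℕ) + 1 < n, r (σ i) (σ ⟨i + 1, h⟩)).card ≤
      (Finset.univ.filter fun i : Fin n =>
        ∃ h : (i : ℕ) + 1 < n, r (τ i) (τ ⟨i + 1, h⟩)).card + 2 * hammingDist σ τ := by
  refine (card_filter_le_of_imp_or_mem
    (q := fun i : Fin n => ∃ h : (i : ℕ) + 1 < n, r (τ i) (τ ⟨i + 1, h⟩))
    ((Finset.univ.filter fun i => σ i ≠ τ i) ∪ (Finset.univ.filter fun i : Fin n =>
      ∃ h : (i : ℕ) + 1 < n, σ ⟨i + 1, h⟩ ≠ τ ⟨i + 1, h⟩)) ?_).trans ?_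
  · rintro i ⟨h, hr⟩
    by_cases h1 : σ i = τ i
    · by_cases h2 : σ ⟨i + 1, h⟩ = τ ⟨i + 1, h⟩
      · left
        exact ⟨h, by rwa [← h1, ← h2]⟩
      · right
        simp only [Finset.mem_union, Finset.mem_filter, Finset.mem_univ, true_and]
        exact Or.inr ⟨h, h2⟩
    · right
      simp only [Finset.mem_union, Finset.mem_filter, Finset.mem_univ, true_and]
      exact Or.inl h1
  · have h1 := card_exists_succ_ne_le_hammingDist σ τ
    have h2 := Finset.card_union_le (Finset.univ.filter fun i => σ i ≠ τ i)
      (Finset.univ.filter fun i : Fin n =>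
        ∃ h : (i : ℕ) + 1 < n, σ ⟨i + 1, h⟩ ≠ τ ⟨i + 1, h⟩)
    have h3 : (Finset.univ.filter fun i => σ i ≠ τ i).card = hammingDist σ τ := rfl
    omega

theorem descents_le_add_hammingDist {n : ℕ} (σ τ : Equiv.Perm (Fin n)) :
    descents n σ ≤ descents n τ + 2 * hammingDist σ τ :=
  card_filter_succ_le_add_hammingDist (fun a b => b < a) σ τ

theorem ascents_le_add_hammingDist {n : ℕ} (σ τ : Equiv.Perm (Fin n)) :
    ascents n σ ≤ ascents n τ + 2 * hammingDist σ τ :=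
  card_filter_succ_le_add_hammingDist (fun a b => a < b) σ τ

theorem exceedances_le_add_hammingDist {n : ℕ} (σ τ : Equiv.Perm (Fin n)) :
    exceedances n σ ≤ exceedances n τ + 2 * hammingDist σ τ := by
  have h : exceedances n σ ≤ exceedances n τ + hammingDist σ τ :=
    card_filter_le_of_imp_or_mem (Finset.univ.filter fun i => σ i ≠ τ i) fun i hi => by
      by_cases h1 : σ i = τ i
      · exact Or.inl (h1 ▸ hi)
      · exact Or.inr (by simpa using h1)
  omega

theorem hammingDist_conj_le {n : ℕ} (ρ σ τ : Equiv.Perm (Fin n)) :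
    hammingDist (ρ * σ * ρ⁻¹ : Equiv.Perm (Fin n)) (ρ * τ * ρ⁻¹ : Equiv.Perm (Fin n)) ≤
      hammingDist σ τ := by
  unfold hammingDist
  refine Finset.card_le_card_of_injOn (fun i => ρ⁻¹ i) ?_ (ρ⁻¹.injective.injOn)
  intro i hi
  simpa using hi

/-- The proportion of permutations `ρ` with `f ρ ≥ a`: the tail of `f` under the uniform law. -/
noncomputable def uniformTail {n : ℕ} (f : Equiv.Perm (Fin n) → ℕ) (a : ℝ) : ℝ :=
  ((Finset.univ.filter fun ρ => a ≤ (f ρ : ℝ)).card : ℝ) / (n.factorial : ℝ)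

/-- The tail of `f` under the uniform law on the conjugacy class of `σ`, that law being encoded
as the law of `ρ σ ρ⁻¹` with `ρ` uniform. -/
noncomputable def conjTail {n : ℕ} (f : Equiv.Perm (Fin n) → ℕ) (σ : Equiv.Perm (Fin n))
    (a : ℝ) : ℝ :=
  uniformTail (fun ρ => f (ρ * σ * ρ⁻¹)) a

theorem uniformTail_nonneg {n : ℕ} (f : Equiv.Perm (Fin n) → ℕ) (a : ℝ) :
    0 ≤ uniformTail f a := by unfold uniformTail; positivity

theorem uniformTail_le_one {n : ℕ} (f : Equiv.Perm (Fin n) → ℕ) (a : ℝ) :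
    uniformTail f a ≤ 1 := by
  unfold uniformTail
  rw [div_le_one (by positivity)]
  have h := Finset.card_filter_le (Finset.univ : Finset (Equiv.Perm (Fin n)))
    (fun ρ => a ≤ (f ρ : ℝ))
  rw [Finset.card_univ, Fintype.card_perm, Fintype.card_fin] at h
  exact_mod_cast h

theorem uniformTail_mono {n : ℕ} {f g : Equiv.Perm (Fin n) → ℕ} {a b : ℝ}
    (h : ∀ ρ, a ≤ (f ρ : ℝ) → b ≤ (g ρ : ℝ)) : uniformTail f a ≤ uniformTail g b := by
  unfold uniformTail
  refine div_le_div_of_nonneg_right (Nat.cast_le.2 (Finset.card_le_card fun ρ hρ => ?_))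
    (by positivity)
  simp only [Finset.mem_filter, Finset.mem_univ, true_and] at hρ ⊢
  exact h ρ hρ

theorem uniformTail_comp_equiv {n : ℕ} (f : Equiv.Perm (Fin n) → ℕ) (a : ℝ)
    (e : Equiv.Perm (Fin n) ≃ Equiv.Perm (Fin n)) :
    uniformTail (fun ρ => f (e ρ)) a = uniformTail f a := by
  unfold uniformTail
  congr 2
  exact Finset.card_equiv e (by simp)

theorem conjTail_conj {n : ℕ} (f : Equiv.Perm (Fin n) → ℕ) (σ e : Equiv.Perm (Fin n)) (a : ℝ) :
    conjTail f (e * σ * e⁻¹) a = conjTail f σ a := by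
  unfold conjTail
  rw [← uniformTail_comp_equiv (fun ρ => f (ρ * σ * ρ⁻¹)) a (Equiv.mulRight e)]
  simp [mul_assoc]

theorem conjTail_le_of_hammingDist_le {n : ℕ} {f : Equiv.Perm (Fin n) → ℕ}
    (hf : ∀ σ τ : Equiv.Perm (Fin n), f σ ≤ f τ + 2 * hammingDist σ τ)
    {σ τ : Equiv.Perm (Fin n)} {k : ℝ} (h : (hammingDist σ τ : ℝ) ≤ k) (a : ℝ) :
    conjTail f σ a ≤ conjTail f τ (a - 2 * k) := by
  refine uniformTail_mono fun ρ hρ => ?_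
  have h1 := (hf (ρ * σ * ρ⁻¹) (ρ * τ * ρ⁻¹)).trans
    (Nat.add_le_add_left (Nat.mul_le_mul_left 2 (hammingDist_conj_le ρ σ τ)) _)
  have h2 : (f (ρ * σ * ρ⁻¹) : ℝ) ≤ f (ρ * τ * ρ⁻¹) + 2 * hammingDist σ τ := by
    exact_mod_cast h1
  linarith

/-- A conjugacy invariant law `w` is a mixture of uniform laws on conjugacy classes. -/
theorem sum_filter_eq_sum_mul_conjTail {n : ℕ} (f : Equiv.Perm (Fin n) → ℕ)
    {w : Equiv.Perm (Fin n) → ℝ} (hw : ∀ ρ σ, w (ρ * σ * ρ⁻¹) = w σ) (a : ℝ) :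
    ∑ σ with a ≤ (f σ : ℝ), w σ = ∑ σ, w σ * conjTail f σ a := by
  have h1 : ∀ ρ : Equiv.Perm (Fin n), ∑ σ with a ≤ (f σ : ℝ), w σ =
      ∑ σ, if a ≤ (f (ρ * σ * ρ⁻¹) : ℝ) then w σ else 0 := by
    intro ρ
    rw [Finset.sum_filter]
    refine (Fintype.sum_equiv (MulAut.conj ρ).toEquiv _ _ fun σ => ?_).symm
    simp [hw]
  have h2 : (n.factorial : ℝ) * ∑ σ with a ≤ (f σ : ℝ), w σ =
      ∑ ρ : Equiv.Perm (Fin n), ∑ σ, if a ≤ (f (ρ * σ * ρ⁻¹) : ℝ) then w σ else 0 := by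
    rw [← Finset.sum_congr rfl fun ρ _ => h1 ρ]
    simp [Fintype.card_perm]
  have h0 : (n.factorial : ℝ) ≠ 0 := by positivity
  rw [← mul_right_inj' h0, h2, Finset.sum_comm, Finset.mul_sum]
  refine Finset.sum_congr rfl fun σ _ => ?_
  rw [← Finset.sum_filter, Finset.sum_const, nsmul_eq_mul, conjTail, uniformTail]
  field_simp

/-- Every permutation is conjugate to one that differs from the rotation in at most as many
places as it has orbits. -/
theorem exists_conj_hammingDist_finRotate_le_card_orbits {n : ℕ} (σ : Equiv.Perm (Fin n)) :
    ∃ e : Equiv.Perm (Fin n),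
      hammingDist (e * σ * e⁻¹ : Equiv.Perm (Fin n)) (finRotate n) ≤
        Nat.card (Quotient (Equiv.Perm.SameCycle.setoid σ)) := by
  classical
  let Q := Quotient (Equiv.Perm.SameCycle.setoid σ)
  let k := Nat.card Q
  let eQ : Fin k ≃ Q := (Finite.equivFin Q).symm
  let r : Fin k → Fin n := fun q => (eQ q).out
  let p : Fin k → ℕ := fun q => Function.minimalPeriod σ (r q)
  have hp : ∀ q, 0 < p q := fun q =>
    Function.minimalPeriod_pos_of_mem_periodicPts (σ.injective.mem_periodicPts (r q))
  -- list each orbit from its representative on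
  let F : (Σ q : Fin k, Fin (p q)) → Fin n := fun x => σ^[x.2] (r x.1)
  have hrF : ∀ x, (Quotient.mk (Equiv.Perm.SameCycle.setoid σ) (F x)) = eQ x.1 := by
    intro x
    rw [← Quotient.out_eq (eQ x.1)]
    refine (Quotient.sound ?_).symm
    refine ⟨(x.2 : ℕ), ?_⟩
    simp [F, r, Equiv.Perm.iterate_eq_pow]
  have hF : Function.Bijective F := by
    constructor
    · rintro ⟨q, i⟩ ⟨q', j⟩ h
      have hq : q = q' := eQ.injective (by rw [← hrF ⟨q, i⟩, ← hrF ⟨q', j⟩, h])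
      subst hq
      have := Function.iterate_injOn_Iio_minimalPeriod (f := σ) (x := r q) i.2 j.2 h
      rw [Fin.ext this]
    · intro y
      obtain ⟨q, hq⟩ := eQ.surjective (Quotient.mk _ y)
      have hs : Equiv.Perm.SameCycle σ (r q) y := by
        have : Quotient.mk (Equiv.Perm.SameCycle.setoid σ) (r q) = Quotient.mk _ y := by
          rw [← hq]; exact Quotient.out_eq _
        exact Quotient.exact this
      obtain ⟨i, hi⟩ := hs.exists_nat_pow_eq
      refine ⟨⟨q, ⟨i % p q, Nat.mod_lt _ (hp q)⟩⟩, ?_⟩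
      rw [← Equiv.Perm.iterate_eq_pow, ← Function.iterate_mod_minimalPeriod_eq] at hi
      exact hi
  let E : (Σ q : Fin k, Fin (p q)) ≃ Fin n := Equiv.ofBijective F hF
  have hsum : ∑ q, p q = n := by
    have := Fintype.card_congr E
    simpa using this
  let e : Equiv.Perm (Fin n) := (E.symm.trans finSigmaFinEquiv).trans (finCongr hsum)
  have hval : ∀ x : (Σ q : Fin k, Fin (p q)), ((e (E x) : Fin n) : ℕ) =
      ∑ i : Fin (x.1 : ℕ), p (Fin.castLE x.1.2.le i) + x.2 := by
    intro x
    simp [e, finSigmaFinEquiv_apply]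
  refine ⟨e, ?_⟩
  -- the two permutations can only differ where an orbit ends
  have hgood : ∀ x : (Σ q : Fin k, Fin (p q)), (x.2 : ℕ) + 1 < p x.1 →
      e (σ (E x)) = finRotate n (e (E x)) := by
    rintro ⟨q, i⟩ hi
    have h1 : σ (E ⟨q, i⟩) = E ⟨q, ⟨i + 1, hi⟩⟩ := by
      simp only [E, F, Equiv.ofBijective_apply]
      rw [Function.iterate_succ_apply']
    have h2 := hval ⟨q, i⟩
    have h3 := hval ⟨q, ⟨i + 1, hi⟩⟩
    rw [h1]
    have hlt := (e (E ⟨q, ⟨i + 1, hi⟩⟩)).2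
    obtain ⟨m, rfl⟩ : ∃ m, n = m + 1 := ⟨n - 1, by omega⟩
    refine Fin.ext ?_
    simp only at h2 h3 hi
    rw [coe_finRotate_of_ne_last]
    · rw [h3, h2]; ring
    · intro hl
      have := congrArg Fin.val hl
      simp only [Fin.val_last] at this
      omega
  let last : Fin k → Fin n := fun q => e (E ⟨q, ⟨p q - 1, Nat.sub_lt (hp q) one_pos⟩⟩)
  have hsub : (Finset.univ.filter fun i =>
      (e * σ * e⁻¹ : Equiv.Perm (Fin n)) i ≠ finRotate n i) ⊆ Finset.univ.image last := by
    intro i hi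
    have hi' := (Finset.mem_filter.1 hi).2
    obtain ⟨⟨q, j⟩, hx⟩ := (E.trans e).surjective i
    have hx' : e (E ⟨q, j⟩) = i := hx
    by_cases hj : (j : ℕ) + 1 < p q
    · refine absurd ?_ hi'
      rw [← hx', ← hgood ⟨q, j⟩ hj]
      simp
    · refine Finset.mem_image.2 ⟨q, Finset.mem_univ _, ?_⟩
      rw [← hx']
      have : j = ⟨p q - 1, Nat.sub_lt (hp q) one_pos⟩ := Fin.ext (by have := j.2; simp only; omega)
      rw [this]
  calc hammingDist (e * σ * e⁻¹ : Equiv.Perm (Fin n)) (finRotate n)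
      ≤ (Finset.univ.image last).card := Finset.card_le_card hsub
    _ ≤ k := Finset.card_image_le.trans (by simp)

theorem card_orbits_le_cycleCount {n : ℕ} (σ : Equiv.Perm (Fin n)) :
    Nat.card (Quotient (Equiv.Perm.SameCycle.setoid σ)) ≤ cycleCount σ := by
  classical
  have hc : Fintype.card (σ.cycleFactorsFinset ⊕ {i // σ i = i}) = cycleCount σ := by
    rw [Fintype.card_sum, Fintype.card_coe, Fintype.card_subtype, cycleCount,
      Equiv.Perm.cycleType_def, Multiset.card_map, Finset.card_val]
  rw [← hc, ← Nat.card_eq_fintype_card]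
  let F : Quotient (Equiv.Perm.SameCycle.setoid σ) → σ.cycleFactorsFinset ⊕ {i // σ i = i} :=
    fun q => if h : σ q.out = q.out then Sum.inr ⟨q.out, h⟩ else
      Sum.inl ⟨σ.cycleOf q.out, Equiv.Perm.cycleOf_mem_cycleFactorsFinset_iff.2
        (Equiv.Perm.mem_support.2 h)⟩
  refine Nat.card_le_card_of_injective F fun q q' h => ?_
  by_cases h1 : σ q.out = q.out <;> by_cases h2 : σ q'.out = q'.out
  · simp only [F, h1, h2, dif_pos, Sum.inr.injEq, Subtype.mk.injEq] at h
    rw [← Quotient.out_eq q, h, Quotient.out_eq]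
  · simp [F, h1, h2] at h
  · simp [F, h1, h2] at h
  · simp only [F, h1, h2, dif_neg, Sum.inl.injEq, Subtype.mk.injEq, not_false_eq_true] at h
    rw [← Quotient.out_eq q, ← Quotient.out_eq q']
    exact Quotient.sound ((Equiv.Perm.sameCycle_iff_cycleOf_eq_of_mem_support
      (Equiv.Perm.mem_support.2 h1) (Equiv.Perm.mem_support.2 h2)).2 h)

/-- Comparison of any conjugacy class with few cycles with the class of the long cycle. -/
theorem conjTail_le_conjTail_finRotate {n : ℕ} {f : Equiv.Perm (Fin n) → ℕ}
    (hf : ∀ σ τ : Equiv.Perm (Fin n), f σ ≤ f τ + 2 * hammingDist σ τ)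
    {σ : Equiv.Perm (Fin n)} {k : ℝ} (h : (cycleCount σ : ℝ) ≤ k) (a : ℝ) :
    conjTail f σ a ≤ conjTail f (finRotate n) (a - 2 * k) ∧
      conjTail f (finRotate n) a ≤ conjTail f σ (a - 2 * k) := by
  obtain ⟨e, he⟩ := exists_conj_hammingDist_finRotate_le_card_orbits σ
  have hd : (hammingDist (e * σ * e⁻¹ : Equiv.Perm (Fin n)) (finRotate n) : ℝ) ≤ k :=
    le_trans (by exact_mod_cast he.trans (card_orbits_le_cycleCount σ)) h
  constructor
  · rw [← conjTail_conj f σ e]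
    exact conjTail_le_of_hammingDist_le hf hd a
  · rw [← conjTail_conj f σ e]
    rw [hammingDist_comm] at hd
    exact conjTail_le_of_hammingDist_le hf hd a

section Mixture

variable {n : ℕ} {f : Equiv.Perm (Fin n) → ℕ} {w : Equiv.Perm (Fin n) → ℝ}

theorem sum_tail_le_conjTail_finRotate
    (hf : ∀ σ τ : Equiv.Perm (Fin n), f σ ≤ f τ + 2 * hammingDist σ τ)
    (hw0 : ∀ σ, 0 ≤ w σ) (hw1 : ∑ σ, w σ = 1) (hw : ∀ ρ σ, w (ρ * σ * ρ⁻¹) = w σ) (a k : ℝ) :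
    ∑ σ with a ≤ (f σ : ℝ), w σ ≤
      ∑ σ with k < (cycleCount σ : ℝ), w σ + conjTail f (finRotate n) (a - 2 * k) := by
  rw [sum_filter_eq_sum_mul_conjTail f hw, Finset.sum_filter,
    ← one_mul (conjTail f (finRotate n) _), ← hw1, Finset.sum_mul, ← Finset.sum_add_distrib]
  refine Finset.sum_le_sum fun σ _ => ?_
  have h0 : 0 ≤ conjTail f (finRotate n) (a - 2 * k) := uniformTail_nonneg _ _
  split_ifs with h
  · have : conjTail f σ a ≤ 1 := uniformTail_le_one _ _
    nlinarith [hw0 σ]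
  · rw [zero_add]
    exact mul_le_mul_of_nonneg_left
      (conjTail_le_conjTail_finRotate hf (not_lt.1 h) a).1 (hw0 σ)

theorem conjTail_finRotate_mul_le_sum_tail
    (hf : ∀ σ τ : Equiv.Perm (Fin n), f σ ≤ f τ + 2 * hammingDist σ τ)
    (hw0 : ∀ σ, 0 ≤ w σ) (hw1 : ∑ σ, w σ = 1) (hw : ∀ ρ σ, w (ρ * σ * ρ⁻¹) = w σ) (a k : ℝ) :
    conjTail f (finRotate n) (a + 2 * k) * (1 - ∑ σ with k < (cycleCount σ : ℝ), w σ) ≤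
      ∑ σ with a ≤ (f σ : ℝ), w σ := by
  rw [sum_filter_eq_sum_mul_conjTail f hw, Finset.sum_filter, ← hw1,
    ← Finset.sum_sub_distrib, Finset.mul_sum]
  refine Finset.sum_le_sum fun σ _ => ?_
  split_ifs with h
  · rw [sub_self, mul_zero]
    exact mul_nonneg (hw0 σ) (uniformTail_nonneg _ _)
  · rw [sub_zero, mul_comm]
    refine mul_le_mul_of_nonneg_left ?_ (hw0 σ)
    have := (conjTail_le_conjTail_finRotate hf (not_lt.1 h) (a + 2 * k)).2
    rwa [add_sub_cancel_right] at this

end Mixture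

theorem sum_filter_uniform_weight {n : ℕ} (f : Equiv.Perm (Fin n) → ℕ) (a : ℝ) :
    ∑ σ with a ≤ (f σ : ℝ), (1 / (n.factorial : ℝ)) = uniformTail f a := by
  rw [Finset.sum_const, nsmul_eq_mul, uniformTail, mul_one_div]

theorem sum_uniform_weight (n : ℕ) :
    ∑ _σ : Equiv.Perm (Fin n), (1 / (n.factorial : ℝ)) = 1 := by
  have h0 : (n.factorial : ℝ) ≠ 0 := by positivity
  simp [Fintype.card_perm, h0]

/-- The exceedances of a random long cycle `ρ c ρ⁻¹` are the cyclic ascents of `ρ`. -/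
theorem ascents_le_exceedances_conj_finRotate {n : ℕ} (ρ : Equiv.Perm (Fin n)) :
    ascents n ρ ≤ exceedances n (ρ * finRotate n * ρ⁻¹) ∧
      exceedances n (ρ * finRotate n * ρ⁻¹) ≤ ascents n ρ + 1 := by
  have h : exceedances n (ρ * finRotate n * ρ⁻¹) =
      (Finset.univ.filter fun i : Fin n => ρ i < ρ (finRotate n i)).card := by
    unfold exceedances
    exact Finset.card_equiv ρ⁻¹ (by simp)
  rw [h]
  have hrot : ∀ (i : Fin n) (hi : (i : ℕ) + 1 < n), finRotate n i = ⟨i + 1, hi⟩ := by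
    intro i hi
    obtain ⟨m, rfl⟩ : ∃ m, n = m + 1 := ⟨n - 1, by omega⟩
    refine Fin.ext ?_
    rw [coe_finRotate_of_ne_last]
    intro hl
    have := congrArg Fin.val hl
    simp only [Fin.val_last] at this
    omega
  constructor
  · refine Finset.card_le_card fun i hi => ?_
    obtain ⟨h1, h2⟩ := (Finset.mem_filter.1 hi).2
    refine Finset.mem_filter.2 ⟨Finset.mem_univ _, ?_⟩
    rwa [hrot i h1]
  · refine (card_filter_le_of_imp_or_mem (q := fun i : Fin n =>
        ∃ h : (i : ℕ) + 1 < n, ρ i < ρ ⟨i + 1, h⟩)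
      (Finset.univ.filter fun i : Fin n => (i : ℕ) + 1 = n) ?_).trans ?_
    · intro i hi
      by_cases h1 : (i : ℕ) + 1 < n
      · exact Or.inl ⟨h1, by rwa [hrot i h1] at hi⟩
      · exact Or.inr (by simp; omega)
    · refine Nat.add_le_add_left (Finset.card_le_one.2 fun i hi j hj => ?_) _
      simp only [Finset.mem_filter, Finset.mem_univ, true_and] at hi hj
      exact Fin.ext (by omega)

theorem descents_revPerm_mul {n : ℕ} (ρ : Equiv.Perm (Fin n)) :
    descents n (Fin.revPerm * ρ) = ascents n ρ := by
  simp [ascents, descents]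

theorem uniformTail_ascents (n : ℕ) (a : ℝ) :
    uniformTail (ascents n) a = uniformTail (descents n) a := by
  rw [← uniformTail_comp_equiv (descents n) a (Equiv.mulLeft Fin.revPerm)]
  simp [descents_revPerm_mul]

/-! ### The number of cycles of a uniform permutation -/

theorem pow_cycleCount_le_card_invariant_colorings {n : ℕ} (K : ℕ) (σ : Equiv.Perm (Fin n)) :
    K ^ cycleCount σ ≤ Nat.card {c : Fin n → Fin K // ∀ i, c (σ i) = c i} := by
  classical
  have hc : Fintype.card (σ.cycleFactorsFinset ⊕ {i // σ i = i}) = cycleCount σ := by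
    rw [Fintype.card_sum, Fintype.card_coe, Fintype.card_subtype, cycleCount,
      Equiv.Perm.cycleType_def, Multiset.card_map, Finset.card_val]
  have hK : K ^ cycleCount σ = Nat.card (σ.cycleFactorsFinset ⊕ {i // σ i = i} → Fin K) := by
    rw [Nat.card_eq_fintype_card, Fintype.card_fun, hc, Fintype.card_fin]
  rw [hK]
  -- the cycle, possibly trivial, through a point
  let C : Fin n → σ.cycleFactorsFinset ⊕ {i // σ i = i} := fun i =>
    if h : σ i = i then Sum.inr ⟨i, h⟩ else
      Sum.inl ⟨σ.cycleOf i, Equiv.Perm.cycleOf_mem_cycleFactorsFinset_iff.2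
        (Equiv.Perm.mem_support.2 h)⟩
  have hCσ : ∀ i, C (σ i) = C i := by
    intro i
    by_cases h : σ i = i
    · rw [h]
    · have h' : σ (σ i) ≠ σ i := fun h' => h (σ.injective h')
      simp only [C, h, h', dif_neg, not_false_eq_true, Sum.inl.injEq, Subtype.mk.injEq]
      exact (Equiv.Perm.SameCycle.cycleOf_eq ⟨1, by simp⟩).symm
  have hCs : Function.Surjective C := by
    rintro (⟨c, hc⟩ | ⟨i, hi⟩)
    · obtain ⟨i, hi⟩ := (Equiv.Perm.mem_cycleFactorsFinset_iff.1 hc).1.nonempty_support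
      have h : σ i ≠ i := Equiv.Perm.mem_support.1
        (Equiv.Perm.mem_cycleFactorsFinset_support_le hc hi)
      refine ⟨i, ?_⟩
      simp only [C, h, dif_neg, not_false_eq_true, Sum.inl.injEq, Subtype.mk.injEq]
      exact (Equiv.Perm.cycle_is_cycleOf hi hc).symm
    · exact ⟨i, by simp [C, hi]⟩
  refine Nat.card_le_card_of_injective (fun F => ⟨fun i => F (C i), fun i => congrArg F (hCσ i)⟩) ?_
  intro F G h
  funext y
  obtain ⟨i, rfl⟩ := hCs y
  exact congrFun (Subtype.ext_iff.1 h) i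

/-- Burnside's lemma for `K`-colorings of `Fin n`: an orbit of colorings is determined by the
sizes of the color classes. -/
theorem sum_pow_cycleCount_le (n K : ℕ) :
    ∑ σ : Equiv.Perm (Fin n), K ^ cycleCount σ ≤ (n + 1) ^ K * n.factorial := by
  classical
  let _ : MulAction (Equiv.Perm (Fin n)) (Fin n → Fin K) := arrowAction
  have hsmul : ∀ (σ : Equiv.Perm (Fin n)) (c : Fin n → Fin K) (i : Fin n),
      (σ • c) i = c (σ⁻¹ i) := fun _ _ _ => rfl
  have hB := MulAction.sum_card_fixedBy_eq_card_orbits_mul_card_group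
    (Equiv.Perm (Fin n)) (Fin n → Fin K)
  rw [Fintype.card_perm, Fintype.card_fin] at hB
  have h1 : ∀ σ : Equiv.Perm (Fin n), K ^ cycleCount σ ≤
      Fintype.card (MulAction.fixedBy (Fin n → Fin K) σ) := by
    intro σ
    refine (pow_cycleCount_le_card_invariant_colorings K σ).trans ?_
    rw [← Nat.card_eq_fintype_card]
    refine Nat.card_le_card_of_injective (fun c => ⟨c.1, ?_⟩) ?_
    · funext i
      rw [hsmul, ← c.2 (σ⁻¹ i)]
      simp
    · intro c d h
      simpa [Subtype.ext_iff] using h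
  refine (Finset.sum_le_sum fun σ _ => h1 σ).trans (hB.le.trans (Nat.mul_le_mul_right _ ?_))
  have h2 : (n + 1) ^ K = Nat.card (Fin K → Fin (n + 1)) := by
    rw [Nat.card_eq_fintype_card, Fintype.card_fun, Fintype.card_fin, Fintype.card_fin]
  rw [h2, ← Nat.card_eq_fintype_card]
  let N : (Fin n → Fin K) → Fin K → Fin (n + 1) := fun c j =>
    ⟨Fintype.card {i // c i = j}, Nat.lt_succ_of_le ((Fintype.card_subtype_le _).trans
      (Fintype.card_fin n).le)⟩
  refine Nat.card_le_card_of_injective (fun q => N q.out) fun q q' h => ?_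
  have he : ∀ j, Nonempty ({i // q.out i = j} ≃ {i // q'.out i = j}) := fun j =>
    Fintype.card_eq.1 (by simpa [N] using congrArg Fin.val (congrFun h j))
  let ρ : Equiv.Perm (Fin n) := Equiv.ofFiberEquiv fun j => (he j).some
  have hρ : ∀ i, q'.out (ρ i) = q.out i := fun i => Equiv.ofFiberEquiv_map _ i
  rw [← Quotient.out_eq q, ← Quotient.out_eq q']
  refine Quotient.sound ⟨ρ⁻¹, ?_⟩
  funext i
  show (ρ⁻¹ • q'.out) i = q.out i
  rw [hsmul, inv_inv, hρ]

theorem sum_uniform_weight_cycleCount_gt_le (n K : ℕ) (hK : 1 ≤ K) (a : ℝ) :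
    ∑ σ : Equiv.Perm (Fin n) with a < (cycleCount σ : ℝ), (1 / (n.factorial : ℝ)) ≤
      ((n : ℝ) + 1) ^ K * (K : ℝ) ^ (-a) := by
  have hK' : (1 : ℝ) ≤ K := by exact_mod_cast hK
  have h0 : (0 : ℝ) < n.factorial := by positivity
  calc ∑ σ : Equiv.Perm (Fin n) with a < (cycleCount σ : ℝ), (1 / (n.factorial : ℝ))
      ≤ ∑ σ : Equiv.Perm (Fin n) with a < (cycleCount σ : ℝ),
          (K : ℝ) ^ (-a) * (K : ℝ) ^ cycleCount σ * (1 / (n.factorial : ℝ)) := by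
        refine Finset.sum_le_sum fun σ hσ => le_mul_of_one_le_left (by positivity) ?_
        rw [← Real.rpow_natCast, ← Real.rpow_add (by linarith)]
        exact Real.one_le_rpow hK' (by linarith [(Finset.mem_filter.1 hσ).2])
    _ ≤ ∑ σ : Equiv.Perm (Fin n),
          (K : ℝ) ^ (-a) * (K : ℝ) ^ cycleCount σ * (1 / (n.factorial : ℝ)) :=
        Finset.sum_le_sum_of_subset_of_nonneg (Finset.filter_subset _ _)
          fun _ _ _ => by positivity
    _ = (K : ℝ) ^ (-a) * (∑ σ : Equiv.Perm (Fin n), (K : ℝ) ^ cycleCount σ) /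
          (n.factorial : ℝ) := by
        rw [← Finset.sum_mul, ← Finset.mul_sum, mul_one_div]
    _ ≤ (K : ℝ) ^ (-a) * (((n : ℝ) + 1) ^ K * n.factorial) / (n.factorial : ℝ) := by
        gcongr
        exact_mod_cast sum_pow_cycleCount_le n K
    _ = ((n : ℝ) + 1) ^ K * (K : ℝ) ^ (-a) := by
        field_simp

/-- A uniform permutation has more than `ε n` cycles with superexponentially small probability. -/
theorem eventually_sum_uniform_weight_cycleCount_gt_le {ε : ℝ} (hε : 0 < ε) (c : ℝ) :
    ∀ᶠ n : ℕ in atTop,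
      ∑ σ : Equiv.Perm (Fin n) with ε * n < (cycleCount σ : ℝ), (1 / (n.factorial : ℝ)) ≤
        Real.exp (-c * n) := by
  obtain ⟨K, hK⟩ := exists_nat_ge (max 1 (Real.exp ((c + 1) / ε)))
  have hK1 : (1 : ℝ) ≤ K := (le_max_left _ _).trans hK
  have hlog : c + 1 ≤ ε * Real.log K := by
    have := Real.log_le_log (Real.exp_pos _) ((le_max_right _ _).trans hK)
    rw [Real.log_exp, div_le_iff₀ hε] at this
    linarith
  have hpoly : ∀ᶠ n : ℕ in atTop, ((n : ℝ) + 1) ^ K ≤ Real.exp n := by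
    have h1 : ∀ᶠ y : ℝ in atTop, y ^ K ≤ Real.exp (-1) * Real.exp y := by
      have := (Real.isLittleO_pow_exp_atTop (n := K)).bound (Real.exp_pos (-1))
      filter_upwards [this, eventually_ge_atTop 0] with y hy hy0
      rwa [Real.norm_of_nonneg (by positivity), Real.norm_of_nonneg (by positivity)] at hy
    have h2 : Tendsto (fun n : ℕ => (n : ℝ) + 1) atTop atTop :=
      tendsto_atTop_add_const_right _ _ tendsto_natCast_atTop_atTop
    filter_upwards [h2.eventually h1] with n hn
    rwa [← Real.exp_add, neg_add_eq_sub, add_sub_cancel_right] at hn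
  filter_upwards [hpoly] with n hn
  refine (sum_uniform_weight_cycleCount_gt_le n K (by exact_mod_cast hK1) (ε * n)).trans ?_
  rw [Real.rpow_def_of_pos (by linarith)]
  refine (mul_le_mul_of_nonneg_right hn (Real.exp_pos _).le).trans ?_
  rw [← Real.exp_add, Real.exp_le_exp]
  nlinarith [mul_le_mul_of_nonneg_right hlog (Nat.cast_nonneg (α := ℝ) n)]

/-! ### The moment generating function of the descents -/

/-- The number of strict descents of a word `w` of length `n + 1`. -/
def wordDescents {n M : ℕ} (w : Fin (n + 1) → Fin M) : ℕ :=
  (Finset.univ.filter fun i : Fin n => w i.succ < w i.castSucc).card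

theorem descents_succ_eq {n : ℕ} (σ : Equiv.Perm (Fin (n + 1))) :
    descents (n + 1) σ = wordDescents σ := by
  unfold descents wordDescents
  symm
  refine Finset.card_bij (fun i _ => i.castSucc) ?_ ?_ ?_
  · intro i hi
    refine Finset.mem_filter.2 ⟨Finset.mem_univ _, by simp, ?_⟩
    exact (Finset.mem_filter.1 hi).2
  · intro i _ j _ h
    exact Fin.castSucc_injective _ h
  · intro i hi
    obtain ⟨h, hlt⟩ := (Finset.mem_filter.1 hi).2
    refine ⟨⟨i, by omega⟩, ?_, rfl⟩
    exact Finset.mem_filter.2 ⟨Finset.mem_univ _, hlt⟩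

/-- Exact transfer-operator computation: a function of the cyclic increment has constant row
sums. -/
theorem sum_prod_cyclic_increment {M : ℕ} [NeZero M] (h : Fin M → ℝ) (n : ℕ) :
    ∑ w : Fin (n + 1) → Fin M, ∏ i : Fin n, h (w i.succ - w i.castSucc) =
      M * (∑ v, h v) ^ n := by
  induction n with
  | zero => simp
  | succ n ih =>
    rw [← (Fin.consEquiv fun _ : Fin (n + 2) => Fin M).sum_comp, Fintype.sum_prod_type_right]
    have : ∀ w : Fin (n + 1) → Fin M, ∑ x : Fin M, ∏ i : Fin (n + 1),
        h (Fin.consEquiv (fun _ : Fin (n + 2) => Fin M) (x, w) i.succ -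
          Fin.consEquiv (fun _ : Fin (n + 2) => Fin M) (x, w) i.castSucc) =
        (∑ v, h v) * ∏ i : Fin n, h (w i.succ - w i.castSucc) := by
      intro w
      rw [← (Equiv.subLeft (w 0)).sum_comp h, Finset.sum_mul]
      refine Finset.sum_congr rfl fun x _ => ?_
      rw [Fin.prod_univ_succ]
      simp [Fin.consEquiv]
    simp_rw [this]
    rw [← Finset.mul_sum, ih]
    ring

theorem abs_sum_cyclic_increment_sub_wordDescents_le {n M : ℕ} [NeZero M]
    (w : Fin (n + 1) → Fin M) :
    |∑ i : Fin n, (((w i.succ - w i.castSucc : Fin M) : ℕ) : ℝ) / M - wordDescents w| ≤ 1 := by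
  have hM : (0 : ℝ) < M := by exact_mod_cast Nat.pos_of_ne_zero (NeZero.ne M)
  have h1 : ∀ i : Fin n, (((w i.succ - w i.castSucc : Fin M) : ℕ) : ℝ) / M =
      (((w i.succ : ℕ) : ℝ) - ((w i.castSucc : ℕ) : ℝ)) / M +
        if w i.succ < w i.castSucc then 1 else 0 := by
    intro i
    have h := Fin.intCast_val_sub_eq_sub_add_ite (w i.succ) (w i.castSucc)
    have h' : (((w i.succ - w i.castSucc : Fin M) : ℕ) : ℝ) =
        ((w i.succ : ℕ) : ℝ) - ((w i.castSucc : ℕ) : ℝ) +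
          ((if w i.castSucc ≤ w i.succ then 0 else M : ℤ) : ℝ) := by exact_mod_cast h
    rw [h', add_div]
    congr 1
    by_cases hle : w i.castSucc ≤ w i.succ
    · simp [hle, not_lt.2 hle]
    · simp [hle, not_le.1 hle, hM.ne']
  have h2 : ∀ m (u : Fin (m + 1) → ℝ), ∑ i : Fin m, (u i.succ - u i.castSucc) =
      u (Fin.last m) - u 0 := by
    intro m
    induction m with
    | zero => intro u; simp
    | succ m ih =>
      intro u
      rw [Fin.sum_univ_castSucc]
      have := ih fun i => u i.castSucc
      simp only [Fin.succ_castSucc, Fin.castSucc_zero] at this ⊢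
      rw [this]
      simp
  have h3 : ∑ i : Fin n, (((w i.succ - w i.castSucc : Fin M) : ℕ) : ℝ) / M - wordDescents w =
      (((w (Fin.last n) : ℕ) : ℝ) - ((w 0 : ℕ) : ℝ)) / M := by
    simp_rw [h1]
    rw [Finset.sum_add_distrib, ← Finset.sum_div, h2 n fun i => ((w i : ℕ) : ℝ), wordDescents]
    simp
  have h4 : ((w (Fin.last n) : ℕ) : ℝ) < M := by exact_mod_cast (w (Fin.last n)).2
  have h5 : ((w 0 : ℕ) : ℝ) < M := by exact_mod_cast (w 0).2
  have h6 : (0 : ℝ) ≤ ((w (Fin.last n) : ℕ) : ℝ) := Nat.cast_nonneg _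
  have h7 : (0 : ℝ) ≤ ((w 0 : ℕ) : ℝ) := Nat.cast_nonneg _
  rw [h3, abs_le, le_div_iff₀ hM, div_le_iff₀ hM]
  constructor <;> linarith

theorem sum_exp_wordDescents_bounds (n M : ℕ) [NeZero M] {t : ℝ} (ht : 0 ≤ t) :
    Real.exp (-t) * (M * (∑ v : Fin M, Real.exp (t * (v : ℕ) / M)) ^ n) ≤
        ∑ w : Fin (n + 1) → Fin M, Real.exp (t * wordDescents w) ∧
      ∑ w : Fin (n + 1) → Fin M, Real.exp (t * wordDescents w) ≤
        Real.exp t * (M * (∑ v : Fin M, Real.exp (t * (v : ℕ) / M)) ^ n) := by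
  have hprod : ∀ w : Fin (n + 1) → Fin M,
      ∏ i : Fin n, Real.exp (t * ((w i.succ - w i.castSucc : Fin M) : ℕ) / M) =
        Real.exp (t * ∑ i : Fin n, (((w i.succ - w i.castSucc : Fin M) : ℕ) : ℝ) / M) := by
    intro w
    rw [← Real.exp_sum, Finset.mul_sum]
    simp_rw [mul_div_assoc]
  rw [← sum_prod_cyclic_increment (fun v : Fin M => Real.exp (t * (v : ℕ) / M)) n,
    Finset.mul_sum, Finset.mul_sum]
  constructor <;> refine Finset.sum_le_sum fun w _ => ?_ <;>
    rw [hprod, ← Real.exp_add, Real.exp_le_exp] <;>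
    have h := abs_le.1 (abs_sum_cyclic_increment_sub_wordDescents_le w)
  · nlinarith [mul_le_mul_of_nonneg_left h.2 ht]
  · nlinarith [mul_le_mul_of_nonneg_left h.1 ht]

/-- An injective word is a strictly increasing word rearranged by a unique permutation. -/
theorem injective_comp_perm_bijective (n M : ℕ) :
    Function.Bijective (fun p : {φ : Fin n → Fin M // StrictMono φ} × Equiv.Perm (Fin n) =>
      (⟨p.1.1 ∘ p.2, p.1.2.injective.comp p.2.injective⟩ :
        {w : Fin n → Fin M // Function.Injective w})) := by
  constructor
  · rintro ⟨⟨φ, hφ⟩, σ⟩ ⟨⟨ψ, hψ⟩, τ⟩ h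
    have h' : φ ∘ σ = ψ ∘ τ := congrArg Subtype.val h
    have hr : Set.range φ = Set.range ψ := by
      rw [← σ.surjective.range_comp φ, h', τ.surjective.range_comp ψ]
    have hφψ : φ = ψ := (hφ.range_inj hψ).1 hr
    subst hφψ
    have : σ = τ := Equiv.ext fun i => hφ.injective (congrFun h' i)
    rw [this]
  · rintro ⟨w, hw⟩
    refine ⟨⟨⟨w ∘ Tuple.sort w, (Tuple.monotone_sort w).strictMono_of_injective
      (hw.comp (Tuple.sort w).injective)⟩, (Tuple.sort w)⁻¹⟩, ?_⟩
    refine Subtype.ext (funext fun i => ?_)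
    simp

theorem sum_injective_exp_wordDescents (n M : ℕ) (t : ℝ) :
    (∑ w : {w : Fin (n + 1) → Fin M // Function.Injective w}, Real.exp (t * wordDescents w.1)) =
      (M.descFactorial (n + 1) : ℝ) / ((n + 1).factorial : ℝ) *
        ∑ σ : Equiv.Perm (Fin (n + 1)), Real.exp (t * descents (n + 1) σ) := by
  classical
  let e := Equiv.ofBijective _ (injective_comp_perm_bijective (n + 1) M)
  have hcard : (M.descFactorial (n + 1) : ℝ) =
      Fintype.card {φ : Fin (n + 1) → Fin M // StrictMono φ} * ((n + 1).factorial : ℝ) := by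
    have h1 := Fintype.card_congr e
    rw [Fintype.card_prod, Fintype.card_perm, Fintype.card_fin,
      Fintype.card_congr (Equiv.subtypeInjectiveEquivEmbedding _ _), Fintype.card_embedding_eq,
      Fintype.card_fin, Fintype.card_fin] at h1
    exact_mod_cast h1.symm
  have h0 : ((n + 1).factorial : ℝ) ≠ 0 := by positivity
  rw [hcard, mul_div_cancel_right₀ _ h0, ← e.sum_comp, Fintype.sum_prod_type]
  have : ∀ (φ : {φ : Fin (n + 1) → Fin M // StrictMono φ}) (σ : Equiv.Perm (Fin (n + 1))),
      wordDescents (e (φ, σ)).1 = descents (n + 1) σ := by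
    intro φ σ
    rw [descents_succ_eq]
    simp [e, wordDescents, φ.2.lt_iff_lt]
  simp [this]

theorem tendsto_geometric_riemann_sum {t : ℝ} (ht : 0 < t) :
    Tendsto (fun M : ℕ => (∑ v : Fin M, Real.exp (t * (v : ℕ) / M)) / M) atTop
      (𝓝 ((Real.exp t - 1) / t)) := by
  have h1 : Tendsto (fun M : ℕ => (Real.exp (t / M) - 1) / (t / M)) atTop (𝓝 1) := by
    have hd : Tendsto (fun y : ℝ => (Real.exp y - 1) / y) (𝓝[≠] 0) (𝓝 1) := by
      have := (Real.hasDerivAt_exp 0).tendsto_slope_zero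
      simpa [div_eq_inv_mul] using this
    refine hd.comp (tendsto_nhdsWithin_iff.2 ⟨tendsto_const_div_atTop_nhds_zero_nat t, ?_⟩)
    filter_upwards [eventually_gt_atTop 0] with M hM
    have : (0 : ℝ) < M := by exact_mod_cast hM
    exact (div_pos ht this).ne'
  have h2 : Tendsto (fun M : ℕ => (Real.exp t - 1) / t / ((Real.exp (t / M) - 1) / (t / M))) atTop
      (𝓝 ((Real.exp t - 1) / t)) := by
    have := (tendsto_const_nhds (x := (Real.exp t - 1) / t)).div h1 one_ne_zero
    rwa [div_one] at this
  refine h2.congr' ?_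
  filter_upwards [eventually_gt_atTop 0] with M hM
  have hM' : (0 : ℝ) < M := by exact_mod_cast hM
  have hne : Real.exp (t / M) - 1 ≠ 0 :=
    (sub_pos.2 (Real.one_lt_exp_iff.2 (div_pos ht hM'))).ne'
  have hs : ∑ v : Fin M, Real.exp (t * (v : ℕ) / M) = (Real.exp t - 1) / (Real.exp (t / M) - 1) := by
    rw [Fin.sum_univ_eq_sum_range (fun v : ℕ => Real.exp (t * v / M)) M]
    have : ∀ v : ℕ, Real.exp (t * v / M) = Real.exp (t / M) ^ v := by
      intro v
      rw [← Real.exp_nat_mul]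
      congr 1
      ring
    simp_rw [this]
    rw [geom_sum_eq (by intro h; exact hne (by rw [h, sub_self])), ← Real.exp_nat_mul]
    congr 3
    field_simp
  rw [hs]
  field_simp

/-- The moment generating function of the descents of a uniform permutation. -/
noncomputable def descentMGF (n : ℕ) (t : ℝ) : ℝ :=
  (∑ σ : Equiv.Perm (Fin n), Real.exp (t * descents n σ)) / (n.factorial : ℝ)

theorem descentMGF_succ_bounds (n : ℕ) {t : ℝ} (ht : 0 < t) :
    Real.exp (-t) * ((Real.exp t - 1) / t) ^ n ≤ descentMGF (n + 1) t ∧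
      descentMGF (n + 1) t ≤ Real.exp t * ((Real.exp t - 1) / t) ^ n := by
  classical
  let W : ℕ → ℝ := fun M => ∑ w : Fin (n + 1) → Fin M, Real.exp (t * wordDescents w)
  let S : ℕ → ℝ := fun M => ∑ v : Fin M, Real.exp (t * (v : ℕ) / M)
  have hdesc : Tendsto (fun M : ℕ => (M.descFactorial (n + 1) : ℝ) / (M : ℝ) ^ (n + 1)) atTop
      (𝓝 1) := by
    have := isEquivalent_descFactorial (n + 1)
    rw [Asymptotics.isEquivalent_iff_tendsto_one] at this
    · exact this
    · filter_upwards [eventually_gt_atTop 0] with M hM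
      positivity
  -- words with a repeated letter are negligible as the alphabet grows
  have hW : Tendsto (fun M : ℕ => W M / (M : ℝ) ^ (n + 1)) atTop (𝓝 (descentMGF (n + 1) t)) := by
    have hlow : ∀ M : ℕ, 0 < M → (M.descFactorial (n + 1) : ℝ) / (M : ℝ) ^ (n + 1) *
        descentMGF (n + 1) t ≤ W M / (M : ℝ) ^ (n + 1) ∧ W M / (M : ℝ) ^ (n + 1) ≤
        (M.descFactorial (n + 1) : ℝ) / (M : ℝ) ^ (n + 1) * descentMGF (n + 1) t +
          Real.exp (t * n) * (1 - (M.descFactorial (n + 1) : ℝ) / (M : ℝ) ^ (n + 1)) := by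
      intro M hM
      have hM' : (0 : ℝ) < (M : ℝ) ^ (n + 1) := by positivity
      have hsplit := Fintype.sum_subtype_add_sum_subtype
        (fun w : Fin (n + 1) → Fin M => Function.Injective w)
        (fun w => Real.exp (t * wordDescents w))
      rw [sum_injective_exp_wordDescents] at hsplit
      have hcard : (Fintype.card {w : Fin (n + 1) → Fin M // ¬ Function.Injective w} : ℝ) =
          (M : ℝ) ^ (n + 1) - M.descFactorial (n + 1) := by
        have h1 := Fintype.card_subtype_compl (fun w : Fin (n + 1) → Fin M => Function.Injective w)
        have h2 := Fintype.card_subtype_le (fun w : Fin (n + 1) → Fin M => Function.Injective w)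
        rw [Fintype.card_congr (Equiv.subtypeInjectiveEquivEmbedding _ _),
          Fintype.card_embedding_eq, Fintype.card_fun, Fintype.card_fin, Fintype.card_fin]
          at h1 h2
        rw [h1, Nat.cast_sub h2]
        push_cast
        rfl
      have hbad0 : 0 ≤ ∑ w : {w : Fin (n + 1) → Fin M // ¬ Function.Injective w},
          Real.exp (t * wordDescents w.1) := Finset.sum_nonneg fun _ _ => (Real.exp_pos _).le
      have hbad1 : ∑ w : {w : Fin (n + 1) → Fin M // ¬ Function.Injective w},
          Real.exp (t * wordDescents w.1) ≤
            Real.exp (t * n) * ((M : ℝ) ^ (n + 1) - M.descFactorial (n + 1)) := by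
        rw [← hcard, mul_comm, ← nsmul_eq_mul]
        refine Finset.sum_le_card_nsmul _ _ _ fun w _ => ?_
        rw [Real.exp_le_exp]
        have : wordDescents w.1 ≤ n := (Finset.card_filter_le _ _).trans (by simp)
        have : (wordDescents w.1 : ℝ) ≤ n := by exact_mod_cast this
        gcongr
      have hmain : (M.descFactorial (n + 1) : ℝ) / ((n + 1).factorial : ℝ) *
          ∑ σ : Equiv.Perm (Fin (n + 1)), Real.exp (t * descents (n + 1) σ) =
          M.descFactorial (n + 1) * descentMGF (n + 1) t := by
        unfold descentMGF
        ring
      rw [hmain] at hsplit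
      have e1 : ∀ y : ℝ, (M.descFactorial (n + 1) : ℝ) / (M : ℝ) ^ (n + 1) * y =
          M.descFactorial (n + 1) * y / (M : ℝ) ^ (n + 1) := fun y => by ring
      have e2 : Real.exp (t * n) * (1 - (M.descFactorial (n + 1) : ℝ) / (M : ℝ) ^ (n + 1)) =
          Real.exp (t * n) * ((M : ℝ) ^ (n + 1) - M.descFactorial (n + 1)) / (M : ℝ) ^ (n + 1) := by
        field_simp
      rw [e1, e2, ← add_div]
      constructor
      · gcongr
        linarith
      · gcongr
        linarith
    have hl : Tendsto (fun M : ℕ => (M.descFactorial (n + 1) : ℝ) / (M : ℝ) ^ (n + 1) *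
        descentMGF (n + 1) t) atTop (𝓝 (descentMGF (n + 1) t)) := by
      simpa using hdesc.mul_const (descentMGF (n + 1) t)
    have hu : Tendsto (fun M : ℕ => (M.descFactorial (n + 1) : ℝ) / (M : ℝ) ^ (n + 1) *
        descentMGF (n + 1) t + Real.exp (t * n) *
          (1 - (M.descFactorial (n + 1) : ℝ) / (M : ℝ) ^ (n + 1))) atTop
        (𝓝 (descentMGF (n + 1) t)) := by
      simpa using hl.add ((hdesc.const_sub 1).const_mul (Real.exp (t * n)))
    refine tendsto_of_tendsto_of_tendsto_of_le_of_le' hl hu ?_ ?_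
    · filter_upwards [eventually_gt_atTop 0] with M hM using (hlow M hM).1
    · filter_upwards [eventually_gt_atTop 0] with M hM using (hlow M hM).2
  have hS : Tendsto (fun M : ℕ => (S M / M) ^ n) atTop (𝓝 (((Real.exp t - 1) / t) ^ n)) :=
    (tendsto_geometric_riemann_sum ht).pow n
  have hbounds : ∀ M : ℕ, 0 < M → Real.exp (-t) * (S M / M) ^ n ≤ W M / (M : ℝ) ^ (n + 1) ∧
      W M / (M : ℝ) ^ (n + 1) ≤ Real.exp t * (S M / M) ^ n := by
    intro M hM
    have : NeZero M := ⟨hM.ne'⟩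
    have hM' : (0 : ℝ) < M := by exact_mod_cast hM
    have h := sum_exp_wordDescents_bounds n M ht.le
    have e : ∀ y : ℝ, y * (S M / M) ^ n = y * (M * S M ^ n) / (M : ℝ) ^ (n + 1) := by
      intro y
      rw [div_pow, pow_succ]
      field_simp
    rw [e, e]
    exact ⟨div_le_div_of_nonneg_right h.1 (by positivity),
      div_le_div_of_nonneg_right h.2 (by positivity)⟩
  constructor
  · refine le_of_tendsto_of_tendsto (hS.const_mul _) hW ?_
    filter_upwards [eventually_gt_atTop 0] with M hM using (hbounds M hM).1
  · refine le_of_tendsto_of_tendsto hW (hS.const_mul _) ?_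
    filter_upwards [eventually_gt_atTop 0] with M hM using (hbounds M hM).2

/-! ### Large deviations of the descents of a uniform permutation -/

/-- The cumulant generating function of the uniform law on `[0, 1]`; its value at `0` is
`log 0 = 0`, as it should be. -/
noncomputable def uniformCGF (t : ℝ) : ℝ := Real.log ((Real.exp t - 1) / t)

theorem exp_uniformCGF {t : ℝ} (ht : t ≠ 0) : Real.exp (uniformCGF t) = (Real.exp t - 1) / t := by
  refine Real.exp_log ?_
  rcases ht.lt_or_gt with h | h
  · exact div_pos_of_neg_of_neg (by linarith [Real.exp_lt_exp.2 h, Real.exp_zero]) h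
  · exact div_pos (by linarith [Real.one_lt_exp_iff.2 h]) h

theorem uniformCGF_nonneg {t : ℝ} (ht : 0 < t) : 0 ≤ uniformCGF t := by
  refine Real.log_nonneg ?_
  rw [le_div_iff₀ ht]
  linarith [Real.add_one_le_exp t]

theorem hasDerivAt_uniformCGF {t : ℝ} (ht : 0 < t) :
    HasDerivAt uniformCGF (Real.exp t / (Real.exp t - 1) - 1 / t) t := by
  have h1 : Real.exp t - 1 ≠ 0 := (sub_pos.2 (Real.one_lt_exp_iff.2 ht)).ne'
  have h := (((Real.hasDerivAt_exp t).sub_const 1).fun_div (hasDerivAt_id' t) ht.ne').log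
    (div_ne_zero h1 ht.ne')
  refine h.congr_deriv ?_
  field_simp

theorem uniformCGF_deriv_le {t : ℝ} (ht : 0 < t) (ht1 : t ≤ 1) :
    Real.exp t / (Real.exp t - 1) - 1 / t ≤ 1 / 2 + t := by
  have h1 : 0 < Real.exp t - 1 := sub_pos.2 (Real.one_lt_exp_iff.2 ht)
  have h2 : 1 + t + t ^ 2 / 2 ≤ Real.exp t := Real.quadratic_le_exp_of_nonneg ht.le
  rw [div_sub_div _ _ h1.ne' ht.ne', div_le_iff₀ (by positivity)]
  nlinarith [mul_le_mul_of_nonneg_left h2 (sub_nonneg.2 ht1),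
    mul_le_mul_of_nonneg_left h2 (by positivity : 0 ≤ (1 / 2 + t) * t), pow_pos ht 3]

/-- The derivative of `uniformCGF` runs through `(1/2, 1)`, values below `y < 1` being reached
at bounded parameters. -/
theorem exists_uniformCGF_deriv_eq {x y : ℝ} (hx : 1 / 2 < x) (hxy : x < y) (hy : y < 1) :
    ∃ t, 0 < t ∧ t ≤ 1 / (1 - y) ∧ HasDerivAt uniformCGF x t := by
  set T := 1 / (1 - y) with hT
  set s := (x - 1 / 2) / 2 with hs
  have hT1 : 1 ≤ T := by
    rw [hT, le_div_iff₀ (by linarith)]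
    linarith
  have hs0 : 0 < s := by rw [hs]; linarith
  have hs1 : s ≤ 1 := by rw [hs]; linarith
  have hcont : ContinuousOn (fun t => Real.exp t / (Real.exp t - 1) - 1 / t) (Set.Icc s T) := by
    have hpos : ∀ t ∈ Set.Icc s T, t ≠ 0 := fun t ht => (hs0.trans_le ht.1).ne'
    have hpos' : ∀ t ∈ Set.Icc s T, Real.exp t - 1 ≠ 0 := fun t ht =>
      (sub_pos.2 (Real.one_lt_exp_iff.2 (hs0.trans_le ht.1))).ne'
    fun_prop (disch := assumption)
  have hlow : Real.exp s / (Real.exp s - 1) - 1 / s ≤ x := by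
    have := uniformCGF_deriv_le hs0 hs1
    linarith
  have hhigh : x ≤ Real.exp T / (Real.exp T - 1) - 1 / T := by
    have h1 : 1 ≤ Real.exp T / (Real.exp T - 1) := by
      rw [le_div_iff₀ (sub_pos.2 (Real.one_lt_exp_iff.2 (by linarith)))]
      linarith
    have h2 : 1 / T = 1 - y := by rw [hT, one_div_one_div]
    linarith
  obtain ⟨t, ht, htx⟩ := intermediate_value_Icc (hs1.trans hT1) hcont ⟨hlow, hhigh⟩
  have ht0 := hs0.trans_le ht.1
  exact ⟨t, ht0, ht.2, htx ▸ hasDerivAt_uniformCGF ht0⟩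

theorem mul_sub_uniformCGF_nonpos {x t : ℝ} (hx : 1 / 2 < x) (ht : t ≤ 0) :
    x * t - uniformCGF t ≤ 0 := by
  rcases ht.eq_or_lt with rfl | ht
  · simp [uniformCGF]
  have h : t / 2 ≤ uniformCGF t := by
    rw [← Real.exp_le_exp, exp_uniformCGF ht.ne, le_div_iff_of_neg ht]
    have h1 : Real.sinh (t / 2) ≤ t / 2 := Real.sinh_le_self_iff.2 (by linarith)
    rw [Real.sinh_eq] at h1
    have h2 : Real.exp t = Real.exp (t / 2) * Real.exp (t / 2) := by
      rw [← Real.exp_add, add_halves]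
    have h3 : Real.exp (t / 2) * Real.exp (-(t / 2)) = 1 := by
      rw [← Real.exp_add, add_neg_cancel, Real.exp_zero]
    nlinarith [mul_le_mul_of_nonneg_left h1 (Real.exp_pos (t / 2)).le]
  nlinarith

theorem exists_pos_mul_sub_uniformCGF_nonneg {x : ℝ} (hx : 1 / 2 < x) :
    ∃ s, 0 < s ∧ 0 ≤ x * s - uniformCGF s := by
  set s := min 1 (x - 1 / 2) with hs
  have hs0 : 0 < s := lt_min one_pos (by linarith)
  have hs1 : s ≤ 1 := min_le_left _ _
  have hsx : s ≤ x - 1 / 2 := min_le_right _ _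
  refine ⟨s, hs0, ?_⟩
  rw [sub_nonneg, ← Real.exp_le_exp, exp_uniformCGF hs0.ne', div_le_iff₀ hs0]
  have h1 : Real.exp s ≤ 1 + s + s ^ 2 / 2 + s ^ 3 * (4 / 18) := by
    refine (Real.exp_bound' hs0.le hs1 (n := 3) (by norm_num)).trans (le_of_eq ?_)
    norm_num [Finset.sum_range_succ, Nat.factorial]
    ring
  have h2 : (x * s + 1) * s ≤ Real.exp (x * s) * s :=
    mul_le_mul_of_nonneg_right (Real.add_one_le_exp _) hs0.le
  nlinarith [mul_le_mul_of_nonneg_left hsx (sq_nonneg s), pow_pos hs0 3]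

theorem descentMGF_bounds {n : ℕ} (hn : 1 ≤ n) {t : ℝ} (ht : 0 < t) :
    Real.exp (-t - uniformCGF t + n * uniformCGF t) ≤ descentMGF n t ∧
      descentMGF n t ≤ Real.exp (t + n * uniformCGF t) := by
  obtain ⟨m, rfl⟩ : ∃ m, n = m + 1 := ⟨n - 1, by omega⟩
  have h := descentMGF_succ_bounds m ht
  rw [← exp_uniformCGF ht.ne', ← Real.exp_nat_mul, ← Real.exp_add, ← Real.exp_add] at h
  have h0 := uniformCGF_nonneg ht
  push_cast
  refine ⟨le_trans (le_of_eq ?_) h.1, h.2.trans ?_⟩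
  · congr 1
    ring
  · rw [Real.exp_le_exp]
    linarith

/-- Markov's inequality, in a form that also serves under an exponential tilt. -/
theorem sum_filter_exp_descents_le {n : ℕ} (s t a : ℝ) {p : Equiv.Perm (Fin n) → Prop}
    [DecidablePred p] (hp : ∀ σ, p σ → 0 ≤ s * (descents n σ - a)) :
    ∑ σ with p σ, Real.exp (t * descents n σ) ≤
      n.factorial * (Real.exp (-s * a) * descentMGF n (t + s)) := by
  have h0 : (n.factorial : ℝ) ≠ 0 := by positivity
  calc ∑ σ with p σ, Real.exp (t * descents n σ)
      ≤ ∑ σ with p σ, Real.exp (-s * a) * Real.exp ((t + s) * descents n σ) := by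
        refine Finset.sum_le_sum fun σ hσ => ?_
        rw [← Real.exp_add, Real.exp_le_exp]
        linarith [hp σ (Finset.mem_filter.1 hσ).2]
    _ ≤ ∑ σ, Real.exp (-s * a) * Real.exp ((t + s) * descents n σ) :=
        Finset.sum_le_sum_of_subset_of_nonneg (Finset.filter_subset _ _)
          fun _ _ _ => by positivity
    _ = n.factorial * (Real.exp (-s * a) * descentMGF n (t + s)) := by
        rw [← Finset.mul_sum, descentMGF]
        field_simp

theorem uniformTail_descents_le {n : ℕ} (hn : 1 ≤ n) {t : ℝ} (ht : 0 < t) (a : ℝ) :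
    uniformTail (descents n) a ≤ Real.exp (t - t * a + n * uniformCGF t) := by
  have h0 : (0 : ℝ) < n.factorial := by positivity
  have h := sum_filter_exp_descents_le (n := n) t 0 a (p := fun σ => a ≤ (descents n σ : ℝ))
    fun σ hσ => mul_nonneg ht.le (sub_nonneg.2 hσ)
  simp only [zero_mul, Real.exp_zero, Finset.sum_const, nsmul_eq_mul, mul_one, zero_add] at h
  unfold uniformTail
  rw [div_le_iff₀' h0]
  refine h.trans (mul_le_mul_of_nonneg_left ?_ h0.le)
  refine (mul_le_mul_of_nonneg_left (descentMGF_bounds hn ht).2 (Real.exp_pos _).le).trans ?_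
  rw [← Real.exp_add]
  exact (congrArg Real.exp (by ring)).le

/-- Cramér's lower bound. Under the law tilted by `exp (t D)`, Markov's inequality and the
differentiability of the cumulant generating function at `t` concentrate `D / n` near `y`. -/
theorem eventually_le_uniformTail_descents {t y δ : ℝ} (ht : 0 < t)
    (hy : HasDerivAt uniformCGF y t) (hδ : 0 < δ) :
    ∀ᶠ n : ℕ in atTop, Real.exp (n * (uniformCGF t - t * y - (t + 1) * δ)) ≤
      uniformTail (descents n) ((y - δ) * n) := by
  obtain ⟨s, hs0, hst, hsp, hsm⟩ : ∃ s, 0 < s ∧ s < t ∧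
      uniformCGF (t + s) ≤ uniformCGF t + s * y + s * (δ / 2) ∧
      uniformCGF (t - s) ≤ uniformCGF t - s * y + s * (δ / 2) := by
    have h := (hasDerivAt_iff_isLittleO_nhds_zero.1 hy).bound (half_pos hδ)
    obtain ⟨r, hr, hrb⟩ := Metric.eventually_nhds_iff.1 h
    have hm : 0 < min r t := lt_min hr ht
    have h1 : min r t / 2 < r := by linarith [min_le_left r t]
    have h2 : min r t / 2 < t := by linarith [min_le_right r t]
    have h3 : |min r t / 2| = min r t / 2 := abs_of_pos (by linarith)
    refine ⟨min r t / 2, by linarith, h2, ?_, ?_⟩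
    · have := hrb (y := min r t / 2) (by rw [Real.dist_eq, sub_zero, h3]; exact h1)
      rw [Real.norm_eq_abs, Real.norm_eq_abs, h3, smul_eq_mul] at this
      linarith [(abs_le.1 this).2]
    · have := hrb (y := -(min r t / 2)) (by rw [Real.dist_eq, sub_zero, abs_neg, h3]; exact h1)
      rw [Real.norm_eq_abs, Real.norm_eq_abs, abs_neg, h3, smul_eq_mul, ← sub_eq_add_neg] at this
      linarith [(abs_le.1 this).2]
  set c := uniformCGF t with hc
  have hlarge : ∀ᶠ n : ℕ in atTop,
      2 * t + s + c + Real.log 4 ≤ n * (s * (δ / 2)) ∧ t + c + Real.log 2 ≤ n * δ := by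
    refine Filter.Eventually.and ?_ ?_
    · exact (tendsto_natCast_atTop_atTop.atTop_mul_const (by positivity)).eventually_ge_atTop _
    · exact (tendsto_natCast_atTop_atTop.atTop_mul_const hδ).eventually_ge_atTop _
  filter_upwards [hlarge, eventually_ge_atTop 1] with n hn hn1
  have hnn : (0 : ℝ) ≤ n := Nat.cast_nonneg n
  have h0 : (0 : ℝ) < n.factorial := by positivity
  set Z := descentMGF n t with hZ
  have hZlow : Real.exp (-t - c + n * c) ≤ Z := (descentMGF_bounds hn1 ht).1
  -- both deviations carry at most a quarter of the tilted mass
  have key : ∀ u, 0 < u → ∀ v, u ≤ t + s →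
      v + n * uniformCGF u ≤ n * c - n * (s * (δ / 2)) →
      Real.exp v * descentMGF n u ≤ Z / 4 := by
    intro u hu v hus hv
    have h1 : Real.exp v * descentMGF n u ≤ Real.exp v * Real.exp (u + n * uniformCGF u) :=
      mul_le_mul_of_nonneg_left (descentMGF_bounds hn1 hu).2 (Real.exp_pos _).le
    refine h1.trans ?_
    rw [le_div_iff₀ (by norm_num : (0 : ℝ) < 4)]
    refine le_trans ?_ hZlow
    rw [← Real.exp_add, ← Real.exp_log (by norm_num : (0 : ℝ) < 4), ← Real.exp_add,
      Real.exp_le_exp]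
    linarith [hn.1]
  have hhigh : ∑ σ with (y + δ) * n < (descents n σ : ℝ), Real.exp (t * descents n σ) ≤
      n.factorial * (Z / 4) := by
    refine (sum_filter_exp_descents_le s t ((y + δ) * n)
      fun σ hσ => mul_nonneg hs0.le (sub_nonneg.2 hσ.le)).trans
      (mul_le_mul_of_nonneg_left (key _ (by linarith) _ le_rfl ?_) h0.le)
    have := mul_le_mul_of_nonneg_left hsp hnn
    linarith
  have hlow : ∑ σ with (descents n σ : ℝ) < (y - δ) * n, Real.exp (t * descents n σ) ≤
      n.factorial * (Z / 4) := by
    refine (sum_filter_exp_descents_le (-s) t ((y - δ) * n)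
      fun σ hσ => mul_nonneg_of_nonpos_of_nonpos (by linarith) (sub_nonpos.2 hσ.le)).trans
      (mul_le_mul_of_nonneg_left (key _ (by linarith) _ (by linarith) ?_) h0.le)
    have := mul_le_mul_of_nonneg_left hsm hnn
    rw [← sub_eq_add_neg]
    linarith
  have hmid : n.factorial * Z ≤
      (∑ σ with (y + δ) * n < (descents n σ : ℝ), Real.exp (t * descents n σ) +
        ∑ σ with (descents n σ : ℝ) < (y - δ) * n, Real.exp (t * descents n σ)) +
      ∑ σ : Equiv.Perm (Fin n) with (y - δ) * n ≤ (descents n σ : ℝ),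
        Real.exp (t * ((y + δ) * n)) := by
    have : n.factorial * Z = ∑ σ : Equiv.Perm (Fin n), Real.exp (t * descents n σ) := by
      rw [hZ, descentMGF]
      field_simp
    rw [this, Finset.sum_filter, Finset.sum_filter, Finset.sum_filter, ← Finset.sum_add_distrib,
      ← Finset.sum_add_distrib]
    refine Finset.sum_le_sum fun σ _ => ?_
    have e1 := Real.exp_pos (t * descents n σ)
    have e2 := Real.exp_pos (t * ((y + δ) * n))
    rcases lt_or_ge ((y + δ) * n) (descents n σ : ℝ) with h1 | h1
    · rw [if_pos h1]
      split_ifs <;> linarith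
    · have e3 : Real.exp (t * descents n σ) ≤ Real.exp (t * ((y + δ) * n)) :=
        Real.exp_le_exp.2 (mul_le_mul_of_nonneg_left h1 ht.le)
      rcases lt_or_ge (descents n σ : ℝ) ((y - δ) * n) with h2 | h2
      · rw [if_pos h2]
        split_ifs <;> linarith
      · rw [if_pos h2]
        split_ifs <;> linarith
  have htail : ∑ σ : Equiv.Perm (Fin n) with (y - δ) * n ≤ (descents n σ : ℝ),
        Real.exp (t * ((y + δ) * n)) =
      n.factorial * (uniformTail (descents n) ((y - δ) * n) * Real.exp (t * ((y + δ) * n))) := by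
    rw [Finset.sum_const, nsmul_eq_mul, uniformTail]
    field_simp
  rw [htail] at hmid
  have hZ2 : Z / 2 ≤ uniformTail (descents n) ((y - δ) * n) * Real.exp (t * ((y + δ) * n)) := by
    refine le_of_mul_le_mul_left ?_ h0
    linarith
  rw [← div_le_iff₀ (Real.exp_pos _)] at hZ2
  refine le_trans ?_ hZ2
  rw [le_div_iff₀ (Real.exp_pos _), le_div_iff₀ two_pos]
  refine le_trans ?_ hZlow
  rw [← Real.exp_add, ← Real.exp_log two_pos, ← Real.exp_add, Real.exp_le_exp]
  linarith [hn.2]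

/-! ### Transfer to conjugacy invariant laws -/

/-- A sequence of statistics whose tails on a random long cycle agree, up to `o(n)` shifts, a
factor `2` and superexponentially small errors, with those of the descents of a uniform permutation. -/
structure TailLikeDescents (f : ∀ n, Equiv.Perm (Fin n) → ℕ) : Prop where
  le_add_hammingDist : ∀ n, ∀ σ τ : Equiv.Perm (Fin n), f n σ ≤ f n τ + 2 * hammingDist σ τ
  conjTail_le : ∀ ε : ℝ, 0 < ε → ∀ᶠ n : ℕ in atTop, ∀ a : ℝ,
    conjTail (f n) (finRotate n) a ≤ 2 * uniformTail (descents n) (a - ε * n)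
  uniformTail_le : ∀ ε : ℝ, 0 < ε → ∀ C : ℝ, ∀ᶠ n : ℕ in atTop, ∀ a : ℝ,
    uniformTail (descents n) (a + ε * n) ≤ conjTail (f n) (finRotate n) a + Real.exp (-C * n)

/-- A uniform permutation has few cycles, hence is close to a random long cycle. -/
theorem TailLikeDescents.of_uniformTail_eq {f : ∀ n, Equiv.Perm (Fin n) → ℕ}
    (hlip : ∀ n, ∀ σ τ : Equiv.Perm (Fin n), f n σ ≤ f n τ + 2 * hammingDist σ τ)
    (hf : ∀ n a, uniformTail (f n) a = uniformTail (descents n) a) : TailLikeDescents f where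
  le_add_hammingDist := hlip
  conjTail_le ε hε := by
    filter_upwards [eventually_sum_uniform_weight_cycleCount_gt_le (half_pos hε) (Real.log 2),
      eventually_ge_atTop 1] with n hn hn1 a
    have hn1' : (1 : ℝ) ≤ n := by exact_mod_cast hn1
    have hb : Real.exp (-Real.log 2 * n) ≤ 1 / 2 := by
      have : Real.exp (-Real.log 2) = 1 / 2 := by
        rw [Real.exp_neg, Real.exp_log two_pos, one_div]
      rw [← this, Real.exp_le_exp]
      nlinarith [Real.log_pos one_lt_two]
    have h := conjTail_finRotate_mul_le_sum_tail (hlip n)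
      (w := fun _ => 1 / (n.factorial : ℝ)) (fun _ => by positivity) (sum_uniform_weight n)
      (fun _ _ => rfl) (a - ε * n) (ε / 2 * n)
    rw [sum_filter_uniform_weight, hf, show a - ε * n + 2 * (ε / 2 * n) = a by ring] at h
    have h0 : 0 ≤ conjTail (f n) (finRotate n) a := uniformTail_nonneg _ _
    nlinarith
  uniformTail_le ε hε C := by
    filter_upwards [eventually_sum_uniform_weight_cycleCount_gt_le (half_pos hε) C] with n hn a
    have h := sum_tail_le_conjTail_finRotate (hlip n)
      (w := fun _ => 1 / (n.factorial : ℝ)) (fun _ => by positivity) (sum_uniform_weight n)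
      (fun _ _ => rfl) (a + ε * n) (ε / 2 * n)
    rw [sum_filter_uniform_weight, hf, show a + ε * n - 2 * (ε / 2 * n) = a by ring] at h
    linarith

/-- On a random long cycle, exceedances are ascents of a uniform permutation up to one, and
ascents and descents of a uniform permutation have the same law. -/
theorem tailLikeDescents_exceedances : TailLikeDescents exceedances where
  le_add_hammingDist _ := exceedances_le_add_hammingDist
  conjTail_le ε hε := by
    filter_upwards [(tendsto_natCast_atTop_atTop.const_mul_atTop hε).eventually_ge_atTop 1]
      with n hn a
    have h : conjTail (exceedances n) (finRotate n) a ≤ uniformTail (ascents n) (a - ε * n) := by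
      refine uniformTail_mono fun ρ hρ => ?_
      have : (exceedances n (ρ * finRotate n * ρ⁻¹) : ℝ) ≤ ascents n ρ + 1 := by
        exact_mod_cast (ascents_le_exceedances_conj_finRotate ρ).2
      linarith
    rw [uniformTail_ascents] at h
    linarith [uniformTail_nonneg (descents n) (a - ε * n)]
  uniformTail_le ε hε C := by
    refine Eventually.of_forall fun n a => ?_
    have h : uniformTail (ascents n) (a + ε * n) ≤ conjTail (exceedances n) (finRotate n) a := by
      refine uniformTail_mono fun ρ hρ => ?_
      have : (ascents n ρ : ℝ) ≤ exceedances n (ρ * finRotate n * ρ⁻¹) := by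
        exact_mod_cast (ascents_le_exceedances_conj_finRotate ρ).1
      have : 0 ≤ ε * n := by positivity
      linarith
    rw [uniformTail_ascents] at h
    linarith [Real.exp_pos (-C * n)]

theorem tailLikeDescents_of_mem {f : ∀ n, Equiv.Perm (Fin n) → ℕ}
    (hf : f ∈ ({descents, ascents, exceedances} : Set (∀ n, Equiv.Perm (Fin n) → ℕ))) :
    TailLikeDescents f := by
  rcases hf with rfl | rfl | rfl
  · exact .of_uniformTail_eq (fun _ => descents_le_add_hammingDist) fun _ _ => rfl
  · exact .of_uniformTail_eq (fun _ => ascents_le_add_hammingDist) uniformTail_ascents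
  · exact tailLikeDescents_exceedances

theorem log_div_le_coe_iff (p : ENNReal) {n : ℕ} (hn : 1 ≤ n) (c : ℝ) :
    ENNReal.log p / ((n : ℝ) : EReal) ≤ (c : EReal) ↔ p ≤ ENNReal.ofReal (Real.exp (c * n)) := by
  have hn' : (0 : EReal) < ((n : ℝ) : EReal) := by
    rw [EReal.coe_pos]
    exact_mod_cast hn
  rw [EReal.div_le_iff_le_mul hn' (EReal.coe_ne_top _), ← EReal.coe_mul, ← EReal.exp_coe,
    ← EReal.exp_le_exp_iff, ENNReal.exp_log, mul_comm]

theorem coe_le_log_div_iff (p : ENNReal) {n : ℕ} (hn : 1 ≤ n) (c : ℝ) :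
    (c : EReal) ≤ ENNReal.log p / ((n : ℝ) : EReal) ↔ ENNReal.ofReal (Real.exp (c * n)) ≤ p := by
  have hn' : (0 : EReal) < ((n : ℝ) : EReal) := by
    rw [EReal.coe_pos]
    exact_mod_cast hn
  rw [EReal.le_div_iff_mul_le hn' (EReal.coe_ne_top _), ← EReal.coe_mul, ← EReal.exp_coe,
    ← EReal.exp_le_exp_iff, ENNReal.exp_log]

section Law

variable {Ω : Type*} [MeasurableSpace Ω] {P : Measure Ω} {n : ℕ}
  {σ : Ω → Equiv.Perm (Fin n)}

theorem sum_filter_law_eq [IsProbabilityMeasure P] (hσ : Measurable σ)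
    (p : Equiv.Perm (Fin n) → Prop) [DecidablePred p] :
    ∑ τ with p τ, P.real (σ ⁻¹' {τ}) = P.real {ω | p (σ ω)} := by
  rw [sum_measureReal_preimage_singleton _ fun y _ => hσ (MeasurableSpace.measurableSet_top)]
  congr 1
  ext ω
  simp

theorem sum_law_eq_one [IsProbabilityMeasure P] (hσ : Measurable σ) :
    ∑ τ, P.real (σ ⁻¹' {τ}) = 1 := by
  rw [sum_measureReal_preimage_singleton _ fun y _ => hσ (MeasurableSpace.measurableSet_top)]
  simp

theorem ConjInvariant.law_conj (h : ConjInvariant P σ) (ρ τ : Equiv.Perm (Fin n)) :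
    P.real (σ ⁻¹' {ρ * τ * ρ⁻¹}) = P.real (σ ⁻¹' {τ}) := by
  have h1 := (h ρ).measure_mem_eq (s := {ρ * τ * ρ⁻¹}) MeasurableSpace.measurableSet_top
  rw [measureReal_def, measureReal_def, ← h1]
  congr 2
  ext ω
  simp

end Law

section LargeDeviations

variable {Ω : ℕ → Type*} [∀ n, MeasurableSpace (Ω n)]
  {P : ∀ n, Measure (Ω n)} {σ : ∀ n, Ω n → Equiv.Perm (Fin n)}

/-- At `α = β = 1`, the second clause of `SatisfiesCI` in terms of real numbers. -/
theorem SatisfiesCI.eventually_le_exp (hCI : SatisfiesCI 1 1 P σ) {ε : ℝ} (hε : 0 < ε) (C : ℝ) :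
    ∀ᶠ n : ℕ in atTop, (P n).real {ω | ε * n < (cycleCount (σ n ω) : ℝ)} ≤ Real.exp (-C * n) := by
  filter_upwards [(hCI.2 ε hε).eventually (gt_mem_nhds (EReal.bot_lt_coe (-C))),
    eventually_ge_atTop 1] with n hn hn1
  have hn0 : (0 : ℝ) < n := by exact_mod_cast hn1
  simp only [Real.rpow_one] at hn
  have h := (log_div_le_coe_iff _ hn1 _).1 hn.le
  simp only [gt_iff_lt, lt_div_iff₀ hn0] at h
  exact ENNReal.toReal_le_of_le_ofReal (Real.exp_pos _).le h

/-- The upper bound: comparison with the descents of a uniform permutation, then Markov's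
inequality at the parameter `t`. -/
theorem eventually_tail_le_exp [∀ n, IsProbabilityMeasure (P n)]
    (hσ : ∀ n, Measurable (σ n)) (hCI : SatisfiesCI 1 1 P σ)
    {f : ∀ n, Equiv.Perm (Fin n) → ℕ} (hf : TailLikeDescents f) {x t c : ℝ} (ht : 0 < t)
    (hc : uniformCGF t - x * t < c) :
    ∀ᶠ n : ℕ in atTop, (P n).real {ω | x * n ≤ (f n (σ n ω) : ℝ)} ≤ Real.exp (c * n) := by
  set η := c - (uniformCGF t - x * t) with hη
  have hη0 : 0 < η := sub_pos.2 hc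
  -- the total shift `3 ε n` costs a factor `exp (3 ε t n)`, half of the available gap
  set ε := η / (6 * t) with hε
  have hε0 : 0 < ε := by positivity
  have hεt : 3 * ε * t = η / 2 := by
    rw [hε]
    field_simp
    norm_num
  filter_upwards [hCI.eventually_le_exp hε0 (1 - c), hf.conjTail_le ε hε0, eventually_ge_atTop 1,
    (tendsto_natCast_atTop_atTop.atTop_mul_const (half_pos hη0)).eventually_ge_atTop
      (t + Real.log 4)] with n h1 h2 hn1 hn
  have hn0 : (1 : ℝ) ≤ n := by exact_mod_cast hn1
  have hmix := sum_tail_le_conjTail_finRotate (hf.le_add_hammingDist n)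
    (w := fun τ => (P n).real (σ n ⁻¹' {τ})) (fun _ => measureReal_nonneg)
    (sum_law_eq_one (hσ n)) (hCI.1 n).law_conj (x * n) (ε * n)
  rw [sum_filter_law_eq (hσ n), sum_filter_law_eq (hσ n)] at hmix
  have h3 := uniformTail_descents_le hn1 ht (x * n - 2 * (ε * n) - ε * n)
  have e1 : Real.exp (-(1 - c) * n) ≤ Real.exp (c * n) / 2 := by
    rw [le_div_iff₀ two_pos, ← Real.exp_log two_pos, ← Real.exp_add, Real.exp_le_exp]
    linarith [Real.log_two_lt_d9]
  have e2 : Real.exp (t - t * (x * n - 2 * (ε * n) - ε * n) + n * uniformCGF t) ≤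
      Real.exp (c * n) / 4 := by
    have h4 : (0 : ℝ) < 4 := by norm_num
    rw [le_div_iff₀ h4, ← Real.exp_log h4, ← Real.exp_add, Real.exp_le_exp]
    have : t * (3 * ε * n) = n * (η / 2) := by rw [← hεt]; ring
    have : n * η = n * c - n * uniformCGF t + n * (x * t) := by rw [hη]; ring
    linarith
  linarith [h2 (x * n - 2 * (ε * n))]

/-- The lower bound: the slope `y > x` leaves room for the `o(n)` shifts made in the comparison
with the descents of a uniform permutation. -/
theorem eventually_exp_le_tail [∀ n, IsProbabilityMeasure (P n)]
    (hσ : ∀ n, Measurable (σ n)) (hCI : SatisfiesCI 1 1 P σ)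
    {f : ∀ n, Equiv.Perm (Fin n) → ℕ} (hf : TailLikeDescents f) {x y t c : ℝ} (ht : 0 < t)
    (hxy : x < y) (hy : HasDerivAt uniformCGF y t) (hc : c < uniformCGF t - t * y) :
    ∀ᶠ n : ℕ in atTop, Real.exp (c * n) ≤ (P n).real {ω | x * n ≤ (f n (σ n ω) : ℝ)} := by
  set η := uniformCGF t - t * y - c with hη
  have hη0 : 0 < η := sub_pos.2 hc
  set δ := min ((y - x) / 4) (η / (2 * (t + 1))) with hδ
  have hδ0 : 0 < δ := lt_min (by linarith) (by positivity)
  have hδ1 : 4 * δ ≤ y - x := by linarith [min_le_left ((y - x) / 4) (η / (2 * (t + 1)))]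
  have hδ2 : (t + 1) * δ ≤ η / 2 := by
    have := min_le_right ((y - x) / 4) (η / (2 * (t + 1)))
    rw [← hδ, le_div_iff₀ (by positivity)] at this
    linarith
  filter_upwards [hCI.eventually_le_exp hδ0 (Real.log 2), hf.uniformTail_le δ hδ0 (-c),
    eventually_ge_atTop 1, eventually_le_uniformTail_descents ht hy hδ0,
    (tendsto_natCast_atTop_atTop.atTop_mul_const (half_pos hη0)).eventually_ge_atTop
      (Real.log 3)] with n h1 h2 hn1 h3 hn
  have hn0 : (1 : ℝ) ≤ n := by exact_mod_cast hn1
  have hmix := conjTail_finRotate_mul_le_sum_tail (hf.le_add_hammingDist n)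
    (w := fun τ => (P n).real (σ n ⁻¹' {τ})) (fun _ => measureReal_nonneg)
    (sum_law_eq_one (hσ n)) (hCI.1 n).law_conj (x * n) (δ * n)
  rw [sum_filter_law_eq (hσ n), sum_filter_law_eq (hσ n)] at hmix
  have e1 : Real.exp (-Real.log 2 * n) ≤ 1 / 2 := by
    have : Real.exp (-Real.log 2) = 1 / 2 := by
      rw [Real.exp_neg, Real.exp_log two_pos, one_div]
    rw [← this, Real.exp_le_exp]
    nlinarith [Real.log_pos one_lt_two]
  have e2 : 3 * Real.exp (c * n) ≤ uniformTail (descents n) ((y - δ) * n) := by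
    refine le_trans ?_ h3
    have h3' : (0 : ℝ) < 3 := by norm_num
    rw [← Real.exp_log h3', ← Real.exp_add, Real.exp_le_exp]
    have : n * ((t + 1) * δ) ≤ n * (η / 2) := mul_le_mul_of_nonneg_left hδ2 (by linarith)
    have : n * η = n * (uniformCGF t - t * y) - n * c := by rw [hη]; ring
    linarith
  have e3 : uniformTail (descents n) ((y - δ) * n) ≤
      uniformTail (descents n) (x * n + 2 * (δ * n) + δ * n) := by
    refine uniformTail_mono fun ρ hρ => le_trans ?_ hρ
    have : (x + 3 * δ) * n ≤ (y - δ) * n :=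
      mul_le_mul_of_nonneg_right (by linarith) (by linarith)
    linarith
  have e4 := h2 (x * n + 2 * (δ * n))
  rw [neg_neg] at e4
  have e5 : 0 ≤ conjTail (f n) (finRotate n) (x * n + 2 * (δ * n)) := uniformTail_nonneg _ _
  nlinarith

end LargeDeviations

/-- Above the mean `1/2`, the supremum defining the rate is approached at positive parameters. -/
theorem exists_pos_lt_of_lt_rateD {x : ℝ} (hx : 1 / 2 < x) {b : EReal} (hb : b < rateD x) :
    ∃ t, 0 < t ∧ b < ((x * t - uniformCGF t : ℝ) : EReal) := by
  obtain ⟨t, ht⟩ := lt_iSup_iff.1 hb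
  rcases lt_or_ge 0 t with h | h
  · exact ⟨t, h, ht⟩
  · obtain ⟨s, hs, hs0⟩ := exists_pos_mul_sub_uniformCGF_nonneg hx
    refine ⟨s, hs, ht.trans_le (EReal.coe_le_coe_iff.2 ?_)⟩
    exact (mul_sub_uniformCGF_nonpos hx h).trans hs0

/-- The rate is right-continuous: parameters for which `uniformCGF` has slope slightly above `x`
stay bounded, and there nearly attain the supremum. -/
theorem exists_slope_gt_of_lt_neg_rateD {x c : ℝ} (hx : 1 / 2 < x) (hx1 : x < 1)
    (hc : (c : EReal) < -rateD x) :
    ∃ y t, x < y ∧ 0 < t ∧ HasDerivAt uniformCGF y t ∧ c < uniformCGF t - t * y := by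
  obtain ⟨d, hcd, hd⟩ := EReal.lt_iff_exists_real_btwn.1 hc
  have hcd' : c < d := EReal.coe_lt_coe_iff.1 hcd
  have hall : ∀ t, x * t - uniformCGF t ≤ -d := by
    intro t
    have h1 : ((x * t - uniformCGF t : ℝ) : EReal) ≤ rateD x :=
      le_iSup (fun t : ℝ => ((x * t - Real.log ((Real.exp t - 1) / t) : ℝ) : EReal)) t
    have h2 : rateD x ≤ ((-d : ℝ) : EReal) := by
      rw [EReal.coe_neg]
      exact (EReal.lt_neg_comm.1 hd).le
    exact EReal.coe_le_coe_iff.1 (h1.trans h2)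
  set z := (x + 1) / 2 with hz
  set T := 1 / (1 - z) with hT
  have hT0 : 0 < T := by
    rw [hT]
    exact one_div_pos.2 (by linarith)
  set r := min ((z - x) / 2) ((d - c) / (2 * T)) with hr
  have hr0 : 0 < r := lt_min (by linarith) (div_pos (by linarith) (by linarith))
  have hrz : r ≤ (z - x) / 2 := min_le_left _ _
  have hrT : r * T ≤ (d - c) / 2 := by
    have := min_le_right ((z - x) / 2) ((d - c) / (2 * T))
    rw [← hr, le_div_iff₀ (by linarith)] at this
    linarith
  obtain ⟨t, ht0, htT, ht⟩ := exists_uniformCGF_deriv_eq (x := x + r) (y := z)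
    (by linarith) (by linarith) (by linarith)
  refine ⟨x + r, t, by linarith, ht0, ht, ?_⟩
  have h1 := hall t
  have h2 : r * t ≤ r * T := mul_le_mul_of_nonneg_left htT hr0.le
  linarith

theorem mainTheorem9 {Ω : ℕ → Type*} [∀ n, MeasurableSpace (Ω n)]
    (P : ∀ n, Measure (Ω n)) [∀ n, IsProbabilityMeasure (P n)]
    (σ : ∀ n, Ω n → Equiv.Perm (Fin n)) (hσ : ∀ n, Measurable (σ n))
    (hCI : SatisfiesCI 1 1 P σ)
    (f : ∀ n, Equiv.Perm (Fin n) → ℕ)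
    (hf : f ∈ ({descents, ascents, exceedances} : Set (∀ n, Equiv.Perm (Fin n) → ℕ)))
    (x : ℝ) (hx : 1 / 2 < x) (hx1 : x < 1) :
    Tendsto (fun n : ℕ =>
      ENNReal.log (P n {ω | (f n (σ n ω) : ℝ) ≥ x * (n : ℝ)}) / ((n : ℝ) : EReal))
      atTop (𝓝 (-rateD x)) := by
  have hf' := tailLikeDescents_of_mem hf
  refine tendsto_order.2 ⟨fun a ha => ?_, fun a ha => ?_⟩
  · obtain ⟨c, hac, hc⟩ := EReal.lt_iff_exists_real_btwn.1 ha
    obtain ⟨y, t, hxy, ht, hy, hct⟩ := exists_slope_gt_of_lt_neg_rateD hx hx1 hc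
    filter_upwards [eventually_exp_le_tail hσ hCI hf' ht hxy hy hct, eventually_ge_atTop 1]
      with n hn hn1
    refine hac.trans_le ((coe_le_log_div_iff _ hn1 c).2 ?_)
    exact ENNReal.ofReal_le_of_le_toReal hn
  · obtain ⟨c, hc, hca⟩ := EReal.lt_iff_exists_real_btwn.1 ha
    obtain ⟨t, ht, hct⟩ := exists_pos_lt_of_lt_rateD hx (EReal.neg_lt_comm.1 hc)
    rw [← EReal.coe_neg, EReal.coe_lt_coe_iff] at hct
    filter_upwards [eventually_tail_le_exp hσ hCI hf' ht (x := x) (c := c) (by linarith),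
      eventually_ge_atTop 1] with n hn hn1
    refine lt_of_le_of_lt ((log_div_le_coe_iff _ hn1 c).2 ?_) hca
    exact (ENNReal.le_ofReal_iff_toReal_le (measure_ne_top _ _) (Real.exp_pos _).le).2 hn
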